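/- Let $n\ge 1$ and $0\le m\le n$. On $\mathbb{C}^{2n+1}=(\mathbb{R}^{2n+1})^{\mathbb{C}}$ let $E_i\in\mathfrak{so}(2n+1)$ ($1\le i\le n$) be the commuting generators of the rotations in $n$ orthogonal coordinate planes, so that $\mathfrak t=\{\sum a_iE_i : a_i\in\mathbb{R}\}$ is a maximal torus; let $L_i$ be given by $L_i(E_j)=\sqrt{-1}\,\delta_{ij}$, take the positive roots $L_i\pm L_j$ $(i<j)$ and $L_i$, and let $H_i=E_1+\dots+E_i$ be the dual basis of the simple roots. Put $\mathfrak I'=\{\xi\in\mathfrak t : \exp(2\pi\xi)=e,\ \alpha(\xi)/\sqrt{-1}\ge 0\text{ for every positive root }\alpha\}$. For $\xi\in\mathfrak I'$ let $\mathfrak g^\xi_j$ be the $\sqrt{-1}\,j$-eigenspace of $\mathrm{ad}\,\xi$ on $\mathfrak{so}(2n+1,\mathbb{C})$ and $\mathfrak p^\xi_i=\bigoplus_{j\le i}\mathfrak g^\xi_j$. Write $\xi\preceq_{\mathcal I}\xi'$ if $\mathfrak p_i^{\xi}\subseteq\mathfrak p_i^{\xi'}$ for all $i\ge 0$ and $\exp(\pi(\xi-\xi'))=e$.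 A symmetric canonical element of $SO(2n+1)$ is a maximal element of $(\mathfrak I',\preceq_{\mathcal I})$. For $\xi\in\mathfrak I'$ let $N_\xi=\{g\exp(\pi\xi)g^{-1} : g\in SO(2n+1)\}$. Let $G^{\mathbb R}_m(2n+1)$ be the set of complex $m$-dimensional subspaces $V=\overline V$ of $\mathbb{C}^{2n+1}$, embedded in $SO(2n+1)$ by $\iota(V)=\pi_V^\perp-\pi_V$ if $m$ is even and $\iota(V)=\pi_V-\pi_V^\perp$ if $m$ is odd, where $\pi_V$ and $\pi_V^\perp$ are the orthogonal projections onto $V$ and $V^\perp$. For a finite-dimensional irreducible representation $\rho$ of $\mathfrak{so}(2n+1,\mathbb{C})$ with highest weight $\omega^*$ and lowest weight $\varpi^*$ let $r_\rho(\xi)=(\omega^*(\xi)-\varpi^*(\xi))/\sqrt{-1}$. For $1\le k\le n$ let $\rho_k$ be the irreducible representation with highest weight $\omega_k$, where $\omega_k=L_1+\dots+L_k$ if $k<n$ and $\omega_n=\tfrac12(L_1+\dots+L_n)$. **Proposition.** Let $\xi$ be a symmetric canonical element of $SO(2n+1)$ with $N_\xi=\iota(G^{\mathbb R}_m(2n+1))$.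 For $1\le k\le n$: 1. $r_{\rho_k}(\xi)\le 2mk$ if $k\le n-m+1$; 2. $r_{\rho_k}(\xi)\le 2m(n-m+1)+(k-n+m-1)(m+n-k)$ if $n-m+1<k<n$. In particular $r_{\rho_1}(\xi)\le 2m$, and, if $n\ge 2$, $r_{\rho_2}(\xi)\le 4m$ when $m<n$ and $r_{\rho_2}(\xi)\le 4m-2$ when $m=n$. The same bounds $2m$, respectively $4m$ (if $m<n$) and $4m-2$ (if $m=n$), hold for every $n\ge 1$ for the standard representation on $\mathbb{C}^{2n+1}$, respectively for the adjoint representation. Moreover the element $\xi_I=\sum_{i\in I}H_i$ with $I=\{n-m+1,\dots,n\}$ is symmetric canonical, satisfies $N_{\xi_I}=\iota(G^{\mathbb R}_m(2n+1))$, and maximizes $r_{\rho_k}$ among all such $\xi$, for every $1\le k\le n$. For $\xi=\xi_I$ there is equality in (1) when $k<n$, in (2), and in the bounds for the standard and the adjoint representation. -/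

import Mathlib

universe u

namespace OddOrthogonal

open Matrix

/-- The index set of the coordinates of `ℂ^(2n+1)`: the `n` first coordinates, then their `n`
partners, then one last coordinate. -/
abbrev Idx (n : ℕ) : Type := (Fin n ⊕ Fin n) ⊕ Unit

/-- The complex Lie algebra `𝔰𝔬(2n+1, ℂ)` of skew-symmetric matrices. -/
abbrev so (n : ℕ) := LieAlgebra.Orthogonal.so (Idx n) ℂ

/-- The (real) maximal torus `𝔱` of `𝔰𝔬(2n+1)`, in the coordinates `(a₁, …, aₙ)` of
`a₁ E₁ + ⋯ + aₙ Eₙ`. -/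
abbrev Torus (n : ℕ) : Type := Fin n → ℝ

/-- `E i` is the generator of the rotations in the plane of the `i`-th coordinate and its partner.
It is diagonal, with eigenvalues `√-1, -√-1`, in the isotropic basis
`e i - √-1 e (n+i)`, `e i + √-1 e (n+i)` of that plane, and vanishes on the other coordinates. -/
def E {n : ℕ} (i : Fin n) : Matrix (Idx n) (Idx n) ℂ :=
  Matrix.single (Sum.inl (Sum.inr i)) (Sum.inl (Sum.inl i)) 1
    - Matrix.single (Sum.inl (Sum.inl i)) (Sum.inl (Sum.inr i)) 1

/-- The matrix `∑ aᵢ Eᵢ` of an element of the torus. -/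
def torusMatrix {n : ℕ} (ξ : Torus n) : Matrix (Idx n) (Idx n) ℂ :=
  ∑ i, (ξ i : ℂ) • E i

theorem torusMatrix_mem {n : ℕ} (ξ : Torus n) : torusMatrix ξ ∈ so n := by
  rw [LieAlgebra.Orthogonal.mem_so, torusMatrix, Matrix.transpose_sum, ← Finset.sum_neg_distrib]
  refine Finset.sum_congr rfl fun i _ => ?_
  rw [Matrix.transpose_smul, E, Matrix.transpose_sub, Matrix.transpose_single,
    Matrix.transpose_single, ← smul_neg, neg_sub]

/-- An element of the torus as an element of `𝔰𝔬(2n+1, ℂ)`. -/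
def torusLie {n : ℕ} (ξ : Torus n) : so n := ⟨torusMatrix ξ, torusMatrix_mem ξ⟩

/-- Real linear functionals on `𝔱`. Roots and weights take values in `√-1 ℝ` on `𝔱`; they are
recorded here after division by `√-1`. -/
abbrev Functional (n : ℕ) : Type := Torus n →ₗ[ℝ] ℝ

/-- The basis `L₁, …, Lₙ` dual to `E₁, …, Eₙ`. -/
def L {n : ℕ} (i : Fin n) : Functional n := LinearMap.proj i

/-- The positive roots `Lᵢ ± Lⱼ` (`i < j`) and `Lᵢ`. -/
def posRoots (n : ℕ) : Set (Functional n) :=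
  {α | (∃ i j : Fin n, i < j ∧ (α = L i - L j ∨ α = L i + L j)) ∨ ∃ i : Fin n, α = L i}

/-- The subspace of `X ∈ 𝔤^ℂ` with `[ξ, X] = √-1 α(ξ) X` for all `ξ ∈ 𝔱`. -/
def rootSpace {n : ℕ} (α : Functional n) : Set (so n) :=
  {X | ∀ ξ : Torus n, ⁅torusLie ξ, X⁆ = (Complex.I * (α ξ : ℂ)) • X}

/-- The basis of `𝔱` dual to the simple roots `L₁ - L₂, …, Lₙ₋₁ - Lₙ, Lₙ`:
`Hᵢ = E₁ + ⋯ + Eᵢ`. -/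
def H {n : ℕ} (i : Fin n) : Torus n := fun j => if j ≤ i then 1 else 0

/-- The fundamental weights (with `k` running from `1` to `n`): `ω_k = L₁ + ⋯ + L_k` for `k < n`
and `ω_n = (L₁ + ⋯ + Lₙ) / 2`. -/
noncomputable def fundamentalWeight (n k : ℕ) : Functional n :=
  if k < n then ∑ i : Fin n with i.val < k, L i else (1 / 2 : ℝ) • ∑ i : Fin n, L i

/-! ### The integer lattice and the symmetric canonical elements -/

/-- The integer lattice `(2π)⁻¹ exp⁻¹(e) ∩ 𝔱` of `SO(2n+1)`. -/
def integerLattice (n : ℕ) : Set (Torus n) :=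
  {ξ | NormedSpace.exp ((2 * Real.pi : ℂ) • torusMatrix ξ) = 1}

/-- The lattice `π⁻¹ exp⁻¹(e) ∩ 𝔱`. -/
def evenLattice (n : ℕ) : Set (Torus n) :=
  {ξ | NormedSpace.exp ((Real.pi : ℂ) • torusMatrix ξ) = 1}

/-- The elements of the integer lattice on which all positive roots are nonnegative. -/
def dominantLattice (n : ℕ) : Set (Torus n) :=
  {ξ | ξ ∈ integerLattice n ∧ ∀ α ∈ posRoots n, 0 ≤ α ξ}

/-- The `√-1 j`-eigenspace of `ad ξ` on `𝔰𝔬(2n+1, ℂ)`. -/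
def adEigenspace {n : ℕ} (ξ : Torus n) (j : ℤ) : Submodule ℂ (so n) :=
  Module.End.eigenspace (LieAlgebra.ad ℂ (so n) (torusLie ξ)) (Complex.I * (j : ℂ))

/-- `𝔭ᵢ^ξ`, the sum of the `√-1 j`-eigenspaces of `ad ξ` for `j ≤ i`. -/
def parabolic {n : ℕ} (ξ : Torus n) (i : ℤ) : Submodule ℂ (so n) :=
  ⨆ j : ℤ, ⨆ _ : j ≤ i, adEigenspace ξ j

/-- The partial order `ξ ≼ ξ'`. -/
def Precedes {n : ℕ} (ξ ξ' : Torus n) : Prop :=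
  ∀ i : ℤ, 0 ≤ i → parabolic ξ i ≤ parabolic ξ' i

/-- The partial order `ξ ≼_𝓘 ξ'`. -/
def SymPrecedes {n : ℕ} (ξ ξ' : Torus n) : Prop :=
  Precedes ξ ξ' ∧ ξ - ξ' ∈ evenLattice n

/-- A symmetric canonical element of `SO(2n+1)`: a maximal element for `≼_𝓘`. -/
def IsSymmetricCanonical {n : ℕ} (ξ : Torus n) : Prop :=
  ξ ∈ dominantLattice n ∧ ∀ ξ' ∈ dominantLattice n, SymPrecedes ξ ξ' → ξ = ξ'

/-! ### The symmetric space of `ξ` and the real Grassmannians -/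

/-- The homomorphism `γ_ξ(z) = exp(-√-1 ln(z) ξ)` of the circle (for `ξ` in the integer lattice
the value does not depend on the branch of the logarithm). -/
noncomputable def loop {n : ℕ} (ξ : Torus n) (z : ℂ) : Matrix (Idx n) (Idx n) ℂ :=
  NormedSpace.exp ((-Complex.I * Complex.log z) • torusMatrix ξ)

/-- The group `SO(2n+1)`, as a set of complex matrices. -/
def SO (n : ℕ) : Set (Matrix (Idx n) (Idx n) ℂ) :=
  {g | ∃ B ∈ Matrix.specialOrthogonalGroup (Idx n) ℝ, g = B.map (fun x : ℝ => (x : ℂ))}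

/-- The symmetric space `N_ξ = {g γ_ξ(-1) g⁻¹ | g ∈ SO(2n+1)}`. -/
noncomputable def symmetricSpace {n : ℕ} (ξ : Torus n) : Set (Matrix (Idx n) (Idx n) ℂ) :=
  {A | ∃ g ∈ SO n, A = g * loop ξ (-1) * g⁻¹}

/-- The real Grassmannian of the complex `m`-dimensional subspaces of `ℂ^(2n+1)` that are stable
under complex conjugation. -/
def realGrassmannian (n m : ℕ) : Set (Submodule ℂ (EuclideanSpace ℂ (Idx n))) :=
  {V | Module.finrank ℂ V = m ∧
    ∀ x ∈ V, WithLp.toLp 2 (fun i => (starRingEnd ℂ) (x i)) ∈ V}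

/-- The matrix of the orthogonal projection onto `V`. -/
noncomputable def projMatrix {n : ℕ} (V : Submodule ℂ (EuclideanSpace ℂ (Idx n))) :
    Matrix (Idx n) (Idx n) ℂ :=
  (Matrix.toEuclideanCLM (n := Idx n) (𝕜 := ℂ)).symm V.starProjection

/-- The embedding of the real Grassmannian of `m`-dimensional subspaces into `SO(2n+1)`:
`π_V^⊥ - π_V` if `m` is even and `π_V - π_V^⊥` if `m` is odd. -/
noncomputable def grassmannianEmbedding (n m : ℕ)
    (V : Submodule ℂ (EuclideanSpace ℂ (Idx n))) : Matrix (Idx n) (Idx n) ℂ :=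
  if Even m then projMatrix Vᗮ - projMatrix V else projMatrix V - projMatrix Vᗮ

/-- `N_ξ` is the (embedded) real Grassmannian of `m`-dimensional subspaces. -/
def IsAssociated {n : ℕ} (m : ℕ) (ξ : Torus n) : Prop :=
  symmetricSpace ξ = grassmannianEmbedding n m '' realGrassmannian n m

/-! ### Representations and uniton numbers -/

section Representations

variable {n : ℕ} (V : Type u) [AddCommGroup V] [Module ℂ V] [LieRingModule (so n) V]

/-- `ω` is a highest weight of the representation `V`: it is the weight of a nonzero weight vector
that is killed by the root spaces of the positive roots. -/
def IsHighestWeight (ω : Functional n) : Prop :=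
  ∃ v : V, v ≠ 0 ∧ (∀ ξ : Torus n, ⁅torusLie ξ, v⁆ = (Complex.I * (ω ξ : ℂ)) • v) ∧
    ∀ α ∈ posRoots n, ∀ X ∈ rootSpace α, ⁅X, v⁆ = 0

/-- `ω` is a lowest weight of the representation `V`: it is the weight of a nonzero weight vector
that is killed by the root spaces of the negative roots. -/
def IsLowestWeight (ω : Functional n) : Prop :=
  ∃ v : V, v ≠ 0 ∧ (∀ ξ : Torus n, ⁅torusLie ξ, v⁆ = (Complex.I * (ω ξ : ℂ)) • v) ∧
    ∀ α ∈ posRoots n, ∀ X ∈ rootSpace (-α), ⁅X, v⁆ = 0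

/-- The highest weight (it exists and is unique for finite-dimensional irreducible `V`). -/
noncomputable def highestWeight : Functional n := Classical.epsilon (IsHighestWeight V)

/-- The lowest weight (it exists and is unique for finite-dimensional irreducible `V`). -/
noncomputable def lowestWeight : Functional n := Classical.epsilon (IsLowestWeight V)

/-- The uniton number `r_ρ(ξ)`: highest weight minus lowest weight, evaluated at `ξ`. -/
noncomputable def unitonNumber (ξ : Torus n) : ℝ := highestWeight V ξ - lowestWeight V ξ

end Representations

/-- `V` is (isomorphic to) the representation `ρ_k`: finite-dimensional, irreducible, with highest
weight the `k`-th fundamental weight. -/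
structure IsFundamentalRep (n k : ℕ) (V : Type u) [AddCommGroup V] [Module ℂ V]
    [LieRingModule (so n) V] [LieModule ℂ (so n) V] : Prop where
  finiteDimensional : FiniteDimensional ℂ V
  irreducible : LieModule.IsIrreducible ℂ (so n) V
  highestWeight : IsHighestWeight V (fundamentalWeight n k)

/-- The standard representation. -/
abbrev Standard (n : ℕ) : Type := Idx n → ℂ

/-- The adjoint representation. -/
abbrev Adjoint (n : ℕ) : Type := so n

/-- The element `ξ_I = ∑_{i ∈ I} Hᵢ` with `I = {n-m+1, …, n}` (the `i`-th basis vector, counted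
from `1`, has index `i - 1` in `Fin n`). -/
def extremal (n m : ℕ) : Torus n := ∑ i : Fin n with n - m + 1 ≤ i.val + 1, H i

end OddOrthogonal

namespace OddOrthogonal

open Matrix

variable {n : ℕ}

/-! ### Eigenvectors -/

/-! Everything becomes a statement about the coordinates `a₁, …, aₙ` of `ξ`, extended by `aₙ₊₁ = 0`.
Integrality and dominance mean that these are integers with `a₁ ≥ … ≥ aₙ ≥ 0`. Such an element is
symmetric canonical exactly when `aⱼ - aⱼ₊₁ ≤ 1` for all `j`. A larger jump can be shrunk by
subtracting `2 Hⱼ`, which moves up in the order; conversely an element above `ξ` has smaller simple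
root values of the same parity (`IsSymmetricCanonical.coord_le`,
`isSymmetricCanonical_of_coord_le`).

The matrix `exp (π ξ)` is diagonal, with each `(-1)^aⱼ` occurring twice and one further entry `1`.
Both `N_ξ` and the embedded Grassmannian are conjugacy classes of such involutions under `SO(2n+1)`,
so they agree as soon as the traces do (`isAssociated_iff`). The trace makes the number of odd
coordinates `m/2` if `m` is even, and the number of even ones `(m-1)/2` if `m` is odd. Descending to
`0` in steps of at most one, the coordinates take every value `1, …, a₁`, hence at least `⌈a₁/2⌉`
odd and `⌊a₁/2⌋` even values (`parity_count_bounds`). Either way `a₁ ≤ m`, so `aⱼ ≤ min(m, n+1-j)`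
(`IsSymmetricCanonical.coord_le_min`), and these bounds are the coordinates of `ξ_I`
(`coord_extremal`).

A sign change of coordinates acts as `-1` on the torus, so the lowest weight is the negative of the
highest and `r_ρ(ξ) = 2 ω*(ξ)` (`unitonNumber_eq`). For `ρ_k` this is twice (once if `k = n`) the
sum of the first `k` coordinates, which is monotone in them; hence `ξ_I` is a maximum. The
representation theory behind this is an operator on `V` implementing the sign change
(`exists_intertwiner`) and the uniqueness of the highest weight (`highestWeight_unique`). For the
standard and adjoint representations an explicit operator and an invariant form take the place of
irreducibility (`highestWeight_unique_of_form`). -/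

theorem mem_span_of_eigenvector {ι V : Type*} [AddCommGroup V] [Module ℂ V] (f : Module.End ℂ V)
    (w : ι → V) (μ : ι → ℂ) (hw : ∀ i, f (w i) = μ i • w i)
    (hs : Submodule.span ℂ (Set.range w) = ⊤) {x : V} {c : ℂ} (hx : f x = c • x) :
    x ∈ Submodule.span ℂ (w '' {i | μ i = c}) := by
  set A := Submodule.span ℂ (w '' {i | μ i = c})
  set B := Submodule.span ℂ (w '' {i | μ i ≠ c})
  have hAB : A ⊔ B = ⊤ := by
    rw [← Submodule.span_union, ← Set.image_union, ← hs, ← Set.image_univ]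
    congr 2
    ext i
    simp [em]
  have hA : A ≤ f.eigenspace c := by
    rw [Submodule.span_le]
    rintro _ ⟨i, rfl, rfl⟩
    exact Module.End.mem_eigenspace_iff.2 (hw i)
  have hB : B ≤ ⨆ (d : ℂ) (_ : d ≠ c), f.eigenspace d := by
    rw [Submodule.span_le]
    rintro _ ⟨i, hi, rfl⟩
    exact Submodule.mem_iSup_of_mem (μ i) (Submodule.mem_iSup_of_mem hi
      (Module.End.mem_eigenspace_iff.2 (hw i)))
  -- The part `z` of `x` outside the `c`-eigenvectors is itself a `c`-eigenvector lying in the sum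
  -- of the other eigenspaces, so it vanishes. The family need not be independent.
  obtain ⟨y, hy, z, hz, rfl⟩ := Submodule.mem_sup.1 (hAB ▸ Submodule.mem_top : x ∈ A ⊔ B)
  have h1 : z ∈ f.eigenspace c := by
    have := (f.eigenspace c).sub_mem (Module.End.mem_eigenspace_iff.2 hx) (hA hy)
    rwa [add_sub_cancel_left] at this
  have h2 : z = 0 := by
    have := (Module.End.eigenspaces_iSupIndep f) c
    exact (Submodule.disjoint_def.1 this) z h1 (hB hz)
  rw [h2, add_zero]
  exact hy

theorem exists_eigenvalue_eq {ι V : Type*} [AddCommGroup V] [Module ℂ V] (f : Module.End ℂ V)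
    (w : ι → V) (μ : ι → ℂ) (hw : ∀ i, f (w i) = μ i • w i)
    (hs : Submodule.span ℂ (Set.range w) = ⊤) {x : V} {c : ℂ} (hx : f x = c • x) (h0 : x ≠ 0) :
    ∃ i, μ i = c ∧ w i ≠ 0 := by
  by_contra! h
  have := mem_span_of_eigenvector f w μ hw hs hx
  have h2 : Submodule.span ℂ (w '' {i | μ i = c}) = ⊥ := by
    rw [Submodule.span_eq_bot]
    rintro _ ⟨i, hi, rfl⟩
    exact h i hi
  rw [h2] at this
  exact h0 this

/-! ### The isotropic basis and wedges -/

/-- The isotropic basis of `ℂ^(2n+1)` diagonalizing the torus. -/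
noncomputable def isoVec : Idx n → Idx n → ℂ
  | Sum.inl (Sum.inl i) => Pi.single (Sum.inl (Sum.inl i)) 1
      - Complex.I • Pi.single (Sum.inl (Sum.inr i)) 1
  | Sum.inl (Sum.inr i) => Pi.single (Sum.inl (Sum.inl i)) 1
      + Complex.I • Pi.single (Sum.inl (Sum.inr i)) 1
  | Sum.inr _ => Pi.single (Sum.inr ()) 1

/-- The weights of the standard representation. -/
noncomputable def wt : Idx n → Functional n
  | Sum.inl (Sum.inl i) => L i
  | Sum.inl (Sum.inr i) => -L i
  | Sum.inr _ => 0

/-- The index of the dual vector of the isotropic basis. -/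
def dualIdx : Idx n → Idx n
  | Sum.inl (Sum.inl i) => Sum.inl (Sum.inr i)
  | Sum.inl (Sum.inr i) => Sum.inl (Sum.inl i)
  | Sum.inr _ => Sum.inr ()

/-- The value of the bilinear form on a vector of the isotropic basis and its dual. -/
noncomputable def dualVal : Idx n → ℂ
  | Sum.inl _ => 2
  | Sum.inr _ => 1

theorem isoVec_dot (a b : Idx n) :
    isoVec a ⬝ᵥ isoVec b = if b = dualIdx a then dualVal a else 0 := by
  rcases a with (i | i) | i <;> rcases b with (j | j) | j <;>
    simp [isoVec, dualIdx, dualVal, dotProduct_sub, Pi.single_apply, eq_comm] <;>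
    split_ifs <;> simp_all <;> norm_num

theorem E_mulVec (i : Fin n) (x : Idx n → ℂ) :
    E i *ᵥ x = Pi.single (Sum.inl (Sum.inr i)) (x (Sum.inl (Sum.inl i)))
      - Pi.single (Sum.inl (Sum.inl i)) (x (Sum.inl (Sum.inr i))) := by
  rw [E, sub_mulVec]
  ext j
  simp [single_mulVec, Pi.single_apply, Function.update_apply]

theorem E_mulVec_isoVec (i : Fin n) (a : Idx n) :
    E i *ᵥ isoVec a = (Complex.I * ((wt a (Pi.single i 1) : ℝ) : ℂ)) • isoVec a := by
  rw [E_mulVec]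
  rcases a with (j | j) | j
  · by_cases h : i = j
    · subst h
      ext k
      rcases k with (k | k) | k <;> simp [isoVec, wt, L, Pi.single_apply] <;>
        split_ifs <;> simp
    · ext k
      simp [isoVec, wt, L, Pi.single_apply, h, Ne.symm h]
  · by_cases h : i = j
    · subst h
      ext k
      rcases k with (k | k) | k <;> simp [isoVec, wt, L, Pi.single_apply]
      split_ifs <;> simp
    · ext k
      simp [isoVec, wt, L, Pi.single_apply, h, Ne.symm h]
  · simp [isoVec, wt]

theorem torusMatrix_mulVec_isoVec (ξ : Torus n) (a : Idx n) :
    torusMatrix ξ *ᵥ isoVec a = (Complex.I * ((wt a ξ : ℝ) : ℂ)) • isoVec a := by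
  have h : wt a ξ = ∑ i, ξ i * wt a (Pi.single i 1) := by
    conv_lhs => rw [pi_eq_sum_univ' ξ, map_sum]
    refine Finset.sum_congr rfl fun i _ => ?_
    rw [map_smul, smul_eq_mul]
  rw [torusMatrix, sum_mulVec, h]
  push_cast
  rw [Finset.mul_sum, Finset.sum_smul]
  refine Finset.sum_congr rfl fun i _ => ?_
  rw [smul_mulVec, E_mulVec_isoVec, smul_smul]
  congr 1
  ring

theorem span_isoVec : Submodule.span ℂ (Set.range (isoVec (n := n))) = ⊤ := by
  rw [eq_top_iff, ← (Pi.basisFun ℂ (Idx n)).span_eq, Submodule.span_le]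
  have h : ∀ a : Idx n, isoVec a ∈ Submodule.span ℂ (Set.range (isoVec (n := n))) :=
    fun a => Submodule.subset_span ⟨a, rfl⟩
  rintro _ ⟨(i | i) | i, rfl⟩
  · have := Submodule.smul_mem _ (1 / 2 : ℂ)
      (Submodule.add_mem _ (h (Sum.inl (Sum.inl i))) (h (Sum.inl (Sum.inr i))))
    refine (congrArg (· ∈ Submodule.span ℂ (Set.range (isoVec (n := n)))) ?_).mp this
    ext k
    simp [isoVec, Pi.single_apply]
    split_ifs <;> norm_num
  · have := Submodule.smul_mem _ (Complex.I / 2 : ℂ)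
      (Submodule.sub_mem _ (h (Sum.inl (Sum.inl i))) (h (Sum.inl (Sum.inr i))))
    refine (congrArg (· ∈ Submodule.span ℂ (Set.range (isoVec (n := n)))) ?_).mp this
    ext k
    simp [isoVec, Pi.single_apply]
    split_ifs <;> ring_nf <;> simp
  · refine (congrArg (· ∈ Submodule.span ℂ (Set.range (isoVec (n := n)))) ?_).mp (h (Sum.inr i))
    ext k
    simp [isoVec]

theorem so_coe_add (X Y : so n) : (X + Y).1 = X.1 + Y.1 := rfl

theorem so_coe_neg (X : so n) : (-X).1 = -X.1 := rfl

theorem so_coe_smul (c : ℂ) (X : so n) : (c • X).1 = c • X.1 := rfl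

theorem so_coe_lie (X Y : so n) : ⁅X, Y⁆.1 = X.1 * Y.1 - Y.1 * X.1 := rfl

/-- The skew-symmetric matrix `x yᵀ - y xᵀ`. -/
def wedge (x y : Idx n → ℂ) : so n :=
  ⟨vecMulVec x y - vecMulVec y x, by
    rw [LieAlgebra.Orthogonal.mem_so, transpose_sub, transpose_vecMulVec, transpose_vecMulVec,
      neg_sub]⟩

theorem wedge_coe (x y : Idx n → ℂ) :
    (wedge x y).1 = vecMulVec x y - vecMulVec y x := rfl

theorem so_transpose (X : so n) : X.1ᵀ = -X.1 := (LieAlgebra.Orthogonal.mem_so _ _ _).1 X.2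

theorem lie_standard (X : so n) (v : Standard n) : ⁅X, v⁆ = X.1 *ᵥ v := rfl

/-- `wedge` is the equivariant identification of the exterior square of `ℂ^(2n+1)` with the Lie
algebra: skewness of `X` turns multiplication on the right into the action on the second factor. -/
theorem lie_wedge (X : so n) (x y : Idx n → ℂ) :
    ⁅X, wedge x y⁆ = wedge (X.1 *ᵥ x) y + wedge x (X.1 *ᵥ y) := by
  apply Subtype.ext
  have h : ∀ z : Idx n → ℂ, z ᵥ* X.1 = -(X.1 *ᵥ z) := fun z => by
    rw [← mulVec_transpose, so_transpose, neg_mulVec]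
  rw [so_coe_lie, so_coe_add]
  simp only [wedge_coe, mul_sub, sub_mul, mul_vecMulVec, vecMulVec_mul, h, vecMulVec_neg]
  abel

theorem wedge_mulVec (x y z : Idx n → ℂ) :
    (wedge x y).1 *ᵥ z = (y ⬝ᵥ z) • x - (x ⬝ᵥ z) • y := by
  change (vecMulVec x y - vecMulVec y x) *ᵥ z = _
  rw [sub_mulVec, vecMulVec_mulVec, vecMulVec_mulVec]
  ext i
  simp

/-- `wedge` as a bilinear map. -/
def wedgeHom : (Idx n → ℂ) →ₗ[ℂ] (Idx n → ℂ) →ₗ[ℂ] so n :=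
  LinearMap.mk₂ ℂ wedge
    (fun x x' y => Subtype.ext (by
      simp only [wedge_coe, so_coe_add, add_vecMulVec, vecMulVec_add]; abel))
    (fun c x y => Subtype.ext (by
      simp only [wedge_coe, so_coe_smul, smul_vecMulVec, vecMulVec_smul, smul_sub]))
    (fun x y y' => Subtype.ext (by
      simp only [wedge_coe, so_coe_add, add_vecMulVec, vecMulVec_add]; abel))
    (fun c x y => Subtype.ext (by
      simp only [wedge_coe, so_coe_smul, smul_vecMulVec, vecMulVec_smul, smul_sub]))

theorem wedgeHom_apply (x y : Idx n → ℂ) : wedgeHom x y = wedge x y := rfl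

theorem wedge_self (x : Idx n → ℂ) : wedge x x = 0 :=
  Subtype.ext (by rw [wedge_coe, sub_self]; rfl)

theorem wedge_swap (x y : Idx n → ℂ) : wedge y x = -wedge x y :=
  Subtype.ext (by rw [wedge_coe, so_coe_neg, wedge_coe, neg_sub])

theorem wedge_smul_left (c : ℂ) (x y : Idx n → ℂ) : wedge (c • x) y = c • wedge x y := by
  simp only [← wedgeHom_apply, map_smul, LinearMap.smul_apply]

theorem wedge_smul_right (c : ℂ) (x y : Idx n → ℂ) : wedge x (c • y) = c • wedge x y := by
  simp only [← wedgeHom_apply, map_smul]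

theorem wedge_zero_left (y : Idx n → ℂ) : wedge 0 y = 0 := by
  simp only [← wedgeHom_apply, map_zero, LinearMap.zero_apply]

theorem wedge_zero_right (x : Idx n → ℂ) : wedge x 0 = 0 := by
  simp only [← wedgeHom_apply, map_zero]

theorem span_wedge :
    Submodule.span ℂ (Set.range fun p : Idx n × Idx n => wedge (isoVec p.1) (isoVec p.2)) = ⊤ := by
  set S := Submodule.span ℂ (Set.range fun p : Idx n × Idx n => wedge (isoVec p.1) (isoVec p.2))
  have h1 : ∀ (a : Idx n) (y : Idx n → ℂ), wedge (isoVec a) y ∈ S := by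
    intro a y
    have hy : y ∈ Submodule.span ℂ (Set.range (isoVec (n := n))) := by
      rw [span_isoVec]; trivial
    have : Submodule.span ℂ (Set.range (isoVec (n := n))) ≤ S.comap (wedgeHom (isoVec a)) := by
      rw [Submodule.span_le]
      rintro _ ⟨b, rfl⟩
      exact Submodule.subset_span ⟨(a, b), rfl⟩
    exact this hy
  have h2 : ∀ x y : Idx n → ℂ, wedge x y ∈ S := by
    intro x y
    have hx : x ∈ Submodule.span ℂ (Set.range (isoVec (n := n))) := by
      rw [span_isoVec]; trivial
    have : Submodule.span ℂ (Set.range (isoVec (n := n))) ≤ S.comap (wedgeHom.flip y) := by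
      rw [Submodule.span_le]
      rintro _ ⟨b, rfl⟩
      exact h1 b y
    exact this hx
  rw [eq_top_iff]
  intro X _
  -- The sum over all ordered pairs is `X - Xᵀ`, which is `2 X` by skewness.
  have : X = (1 / 2 : ℂ) • ∑ i : Idx n, ∑ j : Idx n,
      X.1 i j • wedge (Pi.single i 1) (Pi.single j 1) := by
    have hX : ∀ i j, X.1 j i = -X.1 i j := fun i j => congrFun (congrFun (so_transpose X) i) j
    apply Subtype.ext
    ext k l
    have hc : ((∑ i : Idx n, ∑ j : Idx n, X.1 i j • wedge (Pi.single i 1) (Pi.single j 1) : so n) :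
        Matrix (Idx n) (Idx n) ℂ) = X.1 - X.1ᵀ := by
      have hm := matrix_eq_sum_single X.1
      conv_rhs => rw [hm]
      simp only [transpose_sum, transpose_single]
      rw [← Finset.sum_sub_distrib]
      simp only [← Finset.sum_sub_distrib]
      simp only [AddSubmonoidClass.coe_finsetSum,
        so_coe_smul, wedge_coe, ← single_eq_single_vecMulVec_single, smul_sub,
        smul_single, smul_eq_mul, mul_one]
    rw [so_coe_smul, hc, so_transpose]
    simp
    ring
  rw [this]
  exact S.smul_mem _ (S.sum_mem fun i _ => S.sum_mem fun j _ => S.smul_mem _ (h2 _ _))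

theorem torusLie_lie_wedge (ξ : Torus n) (a b : Idx n) :
    ⁅torusLie ξ, wedge (isoVec a) (isoVec b)⁆
      = (Complex.I * (((wt a + wt b) ξ : ℝ) : ℂ)) • wedge (isoVec a) (isoVec b) := by
  rw [lie_wedge]
  change wedge (torusMatrix ξ *ᵥ _) _ + wedge _ (torusMatrix ξ *ᵥ _) = _
  rw [torusMatrix_mulVec_isoVec, torusMatrix_mulVec_isoVec, wedge_smul_left, wedge_smul_right,
    ← add_smul]
  push_cast [LinearMap.add_apply]
  rw [mul_add]

theorem wedge_mem_rootSpace (a b : Idx n) :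
    wedge (isoVec a) (isoVec b) ∈ rootSpace (wt a + wt b) :=
  fun ξ => torusLie_lie_wedge ξ a b

theorem wedge_isoVec_ne_zero {a b : Idx n} (h : a ≠ b) : wedge (isoVec a) (isoVec b) ≠ 0 := by
  intro h0
  have hd : dualIdx (dualIdx b) = b := by rcases b with (i | i) | i <;> rfl
  have hv : dualVal b ≠ 0 := by rcases b with (i | i) | i <;> norm_num [dualVal]
  have h1 := wedge_mulVec (isoVec a) (isoVec b) (isoVec (dualIdx b))
  have h3 : ¬ dualIdx b = dualIdx a := fun h4 => h (by
    have : dualIdx (dualIdx a) = a := by rcases a with (i | i) | i <;> rfl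
    rw [← this, ← h4, hd])
  rw [h0, isoVec_dot, isoVec_dot, if_pos rfl, if_neg h3] at h1
  have h2 : isoVec a ⬝ᵥ isoVec (dualIdx a) = 0 := by
    have : isoVec a = 0 := by
      have h5 : dualVal b • isoVec a = 0 := by simpa using h1.symm
      exact (smul_eq_zero.1 h5).resolve_left hv
    rw [this, zero_dotProduct]
  rw [isoVec_dot, if_pos rfl] at h2
  have hv' : dualVal a ≠ 0 := by rcases a with (i | i) | i <;> norm_num [dualVal]
  exact hv' h2

theorem wedge_dual (i : Fin n) :
    wedge (isoVec (Sum.inl (Sum.inl i))) (isoVec (Sum.inl (Sum.inr i)))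
      = (-2 * Complex.I) • torusLie (Pi.single i 1) := by
  have hE : (torusLie (Pi.single i 1)).1 = E i := by
    change torusMatrix _ = _
    rw [torusMatrix, Finset.sum_eq_single i]
    · simp
    · intro j _ hj
      simp [hj]
    · simp
  apply Subtype.ext
  rw [so_coe_smul, hE, E, wedge_coe, single_eq_single_vecMulVec_single,
    single_eq_single_vecMulVec_single]
  ext k l
  simp only [isoVec, Matrix.sub_apply, Matrix.smul_apply, vecMulVec_apply, Pi.sub_apply, Pi.add_apply,
    Pi.smul_apply, smul_eq_mul]
  ring

/-- Every wedge of isotropic basis vectors is a positive or negative root vector, or lies in the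
complexified torus. -/
theorem wedge_cases (a b : Idx n) :
    wt a + wt b ∈ posRoots n ∨ -(wt a + wt b) ∈ posRoots n ∨
      (a ≠ b → wt a + wt b = 0) ∧ ∃ (c : ℂ) (ξ : Torus n),
        wedge (isoVec a) (isoVec b) = c • torusLie ξ := by
  have h0 : ∀ a : Idx n, (a ≠ a → wt a + wt a = 0) ∧ ∃ (c : ℂ) (ξ : Torus n),
      wedge (isoVec a) (isoVec a) = c • torusLie ξ := fun a =>
    ⟨fun h => absurd rfl h, 0, 0, by rw [wedge_self, zero_smul]⟩
  have hp : ∀ i : Fin n, L i ∈ posRoots n := fun i => Or.inr ⟨i, rfl⟩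
  have ha : ∀ i j : Fin n, i ≠ j → L i + L j ∈ posRoots n := by
    intro i j h
    rcases lt_or_gt_of_ne h with h | h
    · exact Or.inl ⟨i, j, h, Or.inr rfl⟩
    · exact Or.inl ⟨j, i, h, Or.inr (add_comm _ _)⟩
  have hs : ∀ i j : Fin n, i < j → L i - L j ∈ posRoots n :=
    fun i j h => Or.inl ⟨i, j, h, Or.inl rfl⟩
  rcases a with (i | i) | i <;> rcases b with (j | j) | j
  · by_cases h : i = j
    · subst h; exact Or.inr (Or.inr (h0 _))
    · exact Or.inl (ha i j h)
  · rcases lt_trichotomy i j with h | rfl | h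
    · exact Or.inl (by simpa [wt, sub_eq_add_neg] using hs i j h)
    · exact Or.inr (Or.inr ⟨fun _ => by simp [wt], _, _, wedge_dual i⟩)
    · exact Or.inr (Or.inl (by simpa [wt, sub_eq_add_neg, add_comm] using hs j i h))
  · exact Or.inl (by simpa [wt] using hp i)
  · rcases lt_trichotomy i j with h | rfl | h
    · exact Or.inr (Or.inl (by simpa [wt, sub_eq_add_neg, add_comm] using hs i j h))
    · exact Or.inr (Or.inr ⟨fun _ => by simp [wt], -(-2 * Complex.I), _, by
        rw [wedge_swap, wedge_dual i, neg_smul]⟩)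
    · exact Or.inl (by simpa [wt, sub_eq_add_neg, add_comm] using hs j i h)
  · by_cases h : i = j
    · subst h; exact Or.inr (Or.inr (h0 _))
    · exact Or.inr (Or.inl (by simpa [wt, add_comm] using ha i j h))
  · exact Or.inr (Or.inl (by simpa [wt] using hp i))
  · exact Or.inl (by simpa [wt] using hp j)
  · exact Or.inr (Or.inl (by simpa [wt] using hp j))
  · exact Or.inr (Or.inr (h0 _))

/-! ### Intertwiners for sign changes -/

section SignChange

/-- Conjugation by the diagonal matrix with entries `ε`. -/
def signConj (ε : Idx n → ℂ) (X : so n) : so n :=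
  ⟨diagonal ε * X.1 * diagonal ε, by
    rw [LieAlgebra.Orthogonal.mem_so, transpose_mul, transpose_mul, diagonal_transpose,
      so_transpose]
    simp [mul_assoc]⟩

theorem signConj_coe (ε : Idx n → ℂ) (X : so n) :
    (signConj ε X).1 = diagonal ε * X.1 * diagonal ε := rfl

theorem signConj_apply (ε : Idx n → ℂ) (X : so n) (i j : Idx n) :
    (signConj ε X).1 i j = ε i * X.1 i j * ε j := by
  simp [signConj_coe]

theorem signConj_signConj (ε ε' : Idx n → ℂ) (X : so n) :
    signConj ε (signConj ε' X) = signConj (ε * ε') X := by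
  apply Subtype.ext
  ext i j
  simp only [signConj_apply, Pi.mul_apply]
  ring

theorem signConj_one (X : so n) : signConj 1 X = X := by
  apply Subtype.ext
  ext i j
  simp [signConj_apply]

theorem signConj_smul (ε : Idx n → ℂ) (c : ℂ) (X : so n) :
    signConj ε (c • X) = c • signConj ε X := by
  apply Subtype.ext
  simp [signConj_coe]

theorem signConj_lie {ε : Idx n → ℂ} (hε : ε * ε = 1) (X Y : so n) :
    signConj ε ⁅X, Y⁆ = ⁅signConj ε X, signConj ε Y⁆ := by
  have hD : diagonal ε * diagonal ε = 1 := by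
    rw [diagonal_mul_diagonal']
    exact (congrArg diagonal hε).trans diagonal_one
  have h : ∀ A B : Matrix (Idx n) (Idx n) ℂ, (diagonal ε * A * diagonal ε) *
      (diagonal ε * B * diagonal ε) = diagonal ε * (A * B) * diagonal ε := by
    intro A B
    calc _ = diagonal ε * A * (diagonal ε * diagonal ε) * B * diagonal ε := by noncomm_ring
      _ = _ := by rw [hD]; noncomm_ring
  apply Subtype.ext
  rw [so_coe_lie, signConj_coe, signConj_coe, signConj_coe, so_coe_lie, h, h, mul_sub, sub_mul]

/-- Flipping exactly one of the two axes of every rotation plane reverses each rotation. -/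
theorem signConj_torusLie {ε : Idx n → ℂ}
    (hε : ∀ i, ε (Sum.inl (Sum.inl i)) * ε (Sum.inl (Sum.inr i)) = -1) (ξ : Torus n) :
    signConj ε (torusLie ξ) = -torusLie ξ := by
  apply Subtype.ext
  have hE : ∀ i, diagonal ε * E i * diagonal ε = -E i := by
    intro i
    ext k l
    have h := hε i
    have h' : ε (Sum.inl (Sum.inr i)) * ε (Sum.inl (Sum.inl i)) = -1 := by rw [mul_comm, h]
    rw [mul_diagonal, diagonal_mul, Matrix.neg_apply, E, Matrix.sub_apply, single_apply,
      single_apply]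
    split_ifs with h1 h2 h2
    · rw [← h1.1] at h2; simp at h2
    · rw [← h1.1, ← h1.2, sub_zero, mul_one, h']
    · rw [← h2.1, ← h2.2, zero_sub, mul_neg_one, neg_mul, h]
    · simp
  change diagonal ε * torusMatrix ξ * diagonal ε = -torusMatrix ξ
  simp only [torusMatrix, Finset.mul_sum, Finset.sum_mul, mul_smul_comm, smul_mul_assoc, hE,
    smul_neg, Finset.sum_neg_distrib]

variable (V : Type u) [AddCommGroup V] [Module ℂ V] [LieRingModule (so n) V]

/-- `V` is isomorphic to its twist by the conjugation with the diagonal matrix `ε`. -/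
def Intertwines (ε : Idx n → ℂ) : Prop :=
  ∃ T : V →ₗ[ℂ] V, Function.Injective T ∧ ∀ (X : so n) (v : V), T ⁅X, v⁆ = ⁅signConj ε X, T v⁆

variable {V}

theorem Intertwines.one : Intertwines V (1 : Idx n → ℂ) :=
  ⟨LinearMap.id, fun _ _ h => h, fun X v => by rw [signConj_one]; rfl⟩

theorem Intertwines.mul {ε ε' : Idx n → ℂ} (h : Intertwines V ε) (h' : Intertwines V ε') :
    Intertwines V (ε * ε') := by
  obtain ⟨T, hT, hT'⟩ := h
  obtain ⟨S, hS, hS'⟩ := h'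
  refine ⟨T ∘ₗ S, hT.comp hS, fun X v => ?_⟩
  rw [LinearMap.comp_apply, hS', hT', signConj_signConj]
  rfl

end SignChange

/-! ### Implementing a rotation by `π` on an irreducible representation -/

section Parity

variable {𝔤 : Type*} [LieRing 𝔤] [LieAlgebra ℂ 𝔤] {V : Type u} [AddCommGroup V] [Module ℂ V]
  [LieRingModule 𝔤 V] [LieModule ℂ 𝔤 V]

theorem lie_eigenvector {F X : 𝔤} {a b : ℂ} {v : V} (hX : ⁅F, X⁆ = a • X) (hv : ⁅F, v⁆ = b • v) :
    ⁅F, ⁅X, v⁆⁆ = (b + a) • ⁅X, v⁆ := by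
  rw [leibniz_lie, hX, hv, smul_lie, lie_smul, add_smul, add_comm]

/-- If `ad F` has eigenvalues `0, ±√-1`, then the automorphism `exp (π ad F) = 1 + 2 (ad F)²` is
implemented on every finite-dimensional irreducible representation. -/
theorem exists_intertwiner [FiniteDimensional ℂ V] (hV : LieModule.IsIrreducible ℂ 𝔤 V) (F : 𝔤)
    (hF : ∀ X : 𝔤, ⁅F, ⁅F, ⁅F, X⁆⁆⁆ = -⁅F, X⁆) :
    ∃ T : V →ₗ[ℂ] V, Function.Injective T ∧
      ∀ (X : 𝔤) (v : V), T ⁅X, v⁆ = ⁅X + (2 : ℂ) • ⁅F, ⁅F, X⁆⁆, T v⁆ := by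
  have hnt : Nontrivial V := (LieSubmodule.nontrivial_iff ℂ 𝔤 V).1 hV.toNontrivial
  set f : Module.End ℂ V := LieModule.toEnd ℂ 𝔤 V F with hf
  -- A single eigenvalue suffices: `ad F` has eigenvalues in `{0, ±√-1}`, so irreducibility puts the
  -- whole spectrum of `F` in `c + √-1 ℤ`.
  obtain ⟨c, hc⟩ := Module.End.exists_eigenvalue f
  obtain ⟨v₀, hv₀⟩ := hc.exists_hasEigenvector
  set W : ℤ → Submodule ℂ V := fun j => f.eigenspace (c + Complex.I * j) with hW
  have hmem : ∀ j v, v ∈ W j ↔ ⁅F, v⁆ = (c + Complex.I * j) • v := fun j v =>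
    Module.End.mem_eigenspace_iff
  -- the components of an element of the Lie algebra
  have hdec : ∀ X : 𝔤, ∃ X₀ X₁ X₂ : 𝔤, X = X₀ + X₁ + X₂ ∧
      X + (2 : ℂ) • ⁅F, ⁅F, X⁆⁆ = X₀ - X₁ - X₂ ∧ ⁅F, X₀⁆ = (0 : ℂ) • X₀ ∧
      ⁅F, X₁⁆ = Complex.I • X₁ ∧ ⁅F, X₂⁆ = (-Complex.I) • X₂ := by
    intro X
    -- These are the projections of `X` to the eigenspaces of `ad F` for `0`, `√-1`, `-√-1`, read
    -- off from `(ad F)³ = -ad F`.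
    refine ⟨X + ⁅F, ⁅F, X⁆⁆, (-1 / 2 : ℂ) • ⁅F, ⁅F, X⁆⁆ - (Complex.I / 2) • ⁅F, X⁆,
      (-1 / 2 : ℂ) • ⁅F, ⁅F, X⁆⁆ + (Complex.I / 2) • ⁅F, X⁆, ?_, ?_, ?_, ?_, ?_⟩
    · module
    · module
    · rw [lie_add, hF, add_neg_cancel, zero_smul]
    · rw [lie_sub, lie_smul, lie_smul, hF, smul_sub, smul_smul, smul_smul, smul_neg]
      have h1 : Complex.I * (Complex.I / 2) = -1 / 2 := by
        rw [← mul_div_assoc, Complex.I_mul_I]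
      rw [h1]
      module
    · rw [lie_add, lie_smul, lie_smul, hF, smul_add, smul_smul, smul_smul, smul_neg]
      have h1 : -Complex.I * (Complex.I / 2) = 1 / 2 := by
        rw [← mul_div_assoc, neg_mul, Complex.I_mul_I, neg_neg]
      rw [h1]
      module
  have hshift : ∀ (X : 𝔤) (k j : ℤ) (v : V), ⁅F, X⁆ = (Complex.I * k) • X → v ∈ W j →
      ⁅X, v⁆ ∈ W (j + k) := by
    intro X k j v hX hv
    rw [hmem] at hv ⊢
    rw [lie_eigenvector hX hv]
    push_cast
    ring_nf
  have hcomp : ∀ X : 𝔤, ∃ X₀ X₁ X₂ : 𝔤, X = X₀ + X₁ + X₂ ∧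
      X + (2 : ℂ) • ⁅F, ⁅F, X⁆⁆ = X₀ - X₁ - X₂ ∧ ∀ j, ∀ v ∈ W j,
        ⁅X₀, v⁆ ∈ W j ∧ ⁅X₁, v⁆ ∈ W (j + 1) ∧ ⁅X₂, v⁆ ∈ W (j - 1) := by
    intro X
    obtain ⟨X₀, X₁, X₂, h, h', h0, h1, h2⟩ := hdec X
    refine ⟨X₀, X₁, X₂, h, h', fun j v hv => ⟨?_, ?_, ?_⟩⟩
    · simpa using hshift X₀ 0 j v (by simpa using h0) hv
    · exact hshift X₁ 1 j v (by simpa using h1) hv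
    · exact hshift X₂ (-1) j v (by simpa using h2) hv
  -- The three components of `X` shift `j` by `0`, `1`, `-1`, so the sum of the `W j` is a nonzero
  -- submodule.
  have htop : ⨆ j, W j = ⊤ := by
    let N : LieSubmodule ℂ 𝔤 V :=
      { (⨆ j, W j : Submodule ℂ V) with
        lie_mem := by
          intro X v hv
          change v ∈ ⨆ j, W j at hv
          change ⁅X, v⁆ ∈ ⨆ j, W j
          obtain ⟨X₀, X₁, X₂, h, -, hX⟩ := hcomp X
          induction hv using Submodule.iSup_induction' with
          | mem j w hw =>
            obtain ⟨h0, h1, h2⟩ := hX j w hw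
            rw [h, add_lie, add_lie]
            exact add_mem (add_mem (Submodule.mem_iSup_of_mem _ h0)
              (Submodule.mem_iSup_of_mem _ h1)) (Submodule.mem_iSup_of_mem _ h2)
          | zero => rw [lie_zero]; exact zero_mem _
          | add x y _ _ hx hy => rw [lie_add]; exact add_mem hx hy }
    have hN : N = ⊤ := by
      refine (hV.eq_bot_or_eq_top N).resolve_left fun h => hv₀.2 ?_
      have : v₀ ∈ N := by
        change v₀ ∈ ⨆ j, W j
        refine Submodule.mem_iSup_of_mem 0 ?_
        rw [hmem]
        simpa [hf] using hv₀.apply_eq_smul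
      rw [h] at this
      exact (LieSubmodule.mem_bot _).1 this
    have := congrArg LieSubmodule.toSubmodule hN
    exact this
  have hind : iSupIndep W := by
    refine (Module.End.eigenspaces_iSupIndep f).comp fun i j hij => ?_
    simpa using hij
  set A : Submodule ℂ V := ⨆ j ∈ {j : ℤ | Even j}, W j with hA
  set B : Submodule ℂ V := ⨆ j ∈ {j : ℤ | ¬ Even j}, W j with hB
  have hAB : IsCompl A B := by
    constructor
    · exact hind.disjoint_biSup_biSup (Set.disjoint_left.2 fun j h h' => h' h)
    · rw [codisjoint_iff, eq_top_iff, ← htop]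
      refine iSup_le fun j => ?_
      by_cases h : Even j
      · exact le_sup_of_le_left (le_biSup W (show j ∈ {j : ℤ | Even j} from h))
      · exact le_sup_of_le_right (le_biSup W (show j ∈ {j : ℤ | ¬ Even j} from h))
  -- `T` is `(-1)^j` on `W j`, that is, `exp (π F)` up to a scalar. Components of `X` that change
  -- the parity of `j` anticommute with `T`, and these are the ones on which `1 + 2 (ad F)²` is
  -- `-1`.
  set T : V →ₗ[ℂ] V := A.projection B hAB - B.projection A hAB.symm with hTdef
  have hTA : ∀ v ∈ A, T v = v := by
    intro v hv
    rw [hTdef, LinearMap.sub_apply, Submodule.projection_apply_of_mem_left hAB hv,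
      Submodule.projection_apply_of_mem_right hAB.symm hv, sub_zero]
  have hTB : ∀ v ∈ B, T v = -v := by
    intro v hv
    rw [hTdef, LinearMap.sub_apply, Submodule.projection_apply_of_mem_right hAB hv,
      Submodule.projection_apply_of_mem_left hAB.symm hv, zero_sub]
  have hTe : ∀ j, Even j → ∀ v ∈ W j, T v = v := fun j hj v hv =>
    hTA v ((le_biSup W (show j ∈ {j : ℤ | Even j} from hj)) hv)
  have hTo : ∀ j, ¬ Even j → ∀ v ∈ W j, T v = -v := fun j hj v hv =>
    hTB v ((le_biSup W (show j ∈ {j : ℤ | ¬ Even j} from hj)) hv)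
  refine ⟨T, ?_, ?_⟩
  · have hTT : ∀ v, T (T v) = v := by
      intro v
      have hv : v ∈ ⨆ j, W j := by rw [htop]; trivial
      induction hv using Submodule.iSup_induction' with
      | mem j w hw =>
        by_cases h : Even j
        · rw [hTe j h w hw, hTe j h w hw]
        · rw [hTo j h w hw, map_neg, hTo j h w hw, neg_neg]
      | zero => simp
      | add x y _ _ hx hy => rw [map_add, map_add, hx, hy]
    exact Function.LeftInverse.injective hTT
  · intro X v
    obtain ⟨X₀, X₁, X₂, h, h', hX⟩ := hcomp X
    have hv : v ∈ ⨆ j, W j := by rw [htop]; trivial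
    rw [h']
    induction hv using Submodule.iSup_induction' with
    | mem j w hw =>
      obtain ⟨h0, h1, h2⟩ := hX j w hw
      rw [h]
      by_cases hj : Even j
      · have hj1 : ¬ Even (j + 1) := by simpa [Int.even_add_one] using hj
        have hj2 : ¬ Even (j - 1) := by simpa [Int.even_sub_one] using hj
        simp only [add_lie, sub_lie, map_add, hTe j hj w hw, hTe j hj _ h0, hTo _ hj1 _ h1,
          hTo _ hj2 _ h2]
        abel
      · have hj1 : Even (j + 1) := by simpa [Int.even_add_one] using hj
        have hj2 : Even (j - 1) := by simpa [Int.even_sub_one] using hj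
        simp only [add_lie, sub_lie, map_add, hTo j hj w hw, hTo j hj _ h0, hTe _ hj1 _ h1,
          hTe _ hj2 _ h2, lie_neg]
        abel
    | zero => simp
    | add x y _ _ hx hy => rw [lie_add, map_add, hx, hy, map_add, lie_add]

end Parity

/-- The sign change at the coordinates `p` and `q`. -/
def planeSign (p q : Idx n) : Idx n → ℂ := fun i => if i = p ∨ i = q then -1 else 1

/-- The generator of the rotations in the plane of the coordinates `p` and `q`. -/
def planeRotation (p q : Idx n) : so n := wedge (Pi.single q 1) (Pi.single p 1)

/-- Here `F³ = -F`, the sign matrix is `1 + 2 F² = exp (π F)`, and every product `F X F` collapses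
to `X p q • F` because `X` is skew. Both identities are then expansions. -/
theorem planeRotation_identities {p q : Idx n} (hpq : p ≠ q) (X : so n) :
    ⁅planeRotation p q, ⁅planeRotation p q, ⁅planeRotation p q, X⁆⁆⁆ = -⁅planeRotation p q, X⁆ ∧
      X + (2 : ℂ) • ⁅planeRotation p q, ⁅planeRotation p q, X⁆⁆ = signConj (planeSign p q) X := by
  set F := (planeRotation p q).1 with hF
  have hFs : F = single q p 1 - single p q 1 := by
    rw [hF, planeRotation, wedge_coe, single_eq_single_vecMulVec_single,
      single_eq_single_vecMulVec_single]
  have hXs : ∀ i j, X.1 j i = -X.1 i j := fun i j => congrFun (congrFun (so_transpose X) i) j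
  have hX0 : ∀ i, X.1 i i = 0 := fun i => by
    have := hXs i i
    have h2 : (2 : ℂ) * X.1 i i = 0 := by linear_combination this
    simpa using h2
  have h1 : F * X.1 * F = X.1 p q • F := by
    rw [hFs]
    simp only [sub_mul, mul_sub, single_mul_mul_single, one_mul, mul_one, hX0, single_zero,
      smul_sub, smul_single, smul_eq_mul, hXs p q]
    have h := single_neg p q (X.1 p q)
    rw [← h]
    abel
  have hF2 : F * F = -(single p p 1 + single q q 1) := by
    rw [hFs]
    simp only [sub_mul, mul_sub, single_mul_single_same, one_mul,
      single_mul_single_of_ne _ _ _ _ hpq, single_mul_single_of_ne _ _ _ _ hpq.symm]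
    abel
  have hF3 : F * F * F = -F := by
    rw [hF2, hFs]
    simp only [mul_sub, neg_mul, add_mul, single_mul_single_same, one_mul,
      single_mul_single_of_ne _ _ _ _ hpq, single_mul_single_of_ne _ _ _ _ hpq.symm]
    abel
  have hD : diagonal (planeSign p q) = 1 + (2 : ℂ) • (F * F) := by
    rw [hF2]
    ext i j
    by_cases hij : i = j
    · subst hij
      by_cases hp : i = p
      · subst hp
        simp [planeSign, hpq.symm]
        norm_num
      · by_cases hq : i = q
        · subst hq
          simp [planeSign, hpq]
          norm_num
        · simp [planeSign, hp, hq, Ne.symm hp, Ne.symm hq]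
    · have h1 : ¬ (p = i ∧ p = j) := fun h => hij (h.1.symm.trans h.2)
      have h2 : ¬ (q = i ∧ q = j) := fun h => hij (h.1.symm.trans h.2)
      simp [hij, h1, h2]
  have h2 : F * F * X.1 * F = X.1 p q • (F * F) := by
    rw [mul_assoc F F, mul_assoc F, h1, mul_smul_comm]
  have h3 : F * X.1 * F * F = X.1 p q • (F * F) := by
    rw [h1, smul_mul_assoc]
  have h4 : F * F * X.1 * F * F = -(X.1 p q • F) := by
    rw [h2, smul_mul_assoc, hF3, smul_neg]
  constructor
  · apply Subtype.ext
    simp only [so_coe_lie, so_coe_neg, ← hF]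
    have : F * (F * (F * X.1 - X.1 * F) - (F * X.1 - X.1 * F) * F)
        - (F * (F * X.1 - X.1 * F) - (F * X.1 - X.1 * F) * F) * F
        = F * F * F * X.1 - (3 : ℂ) • (F * F * X.1 * F) + (3 : ℂ) • (F * X.1 * F * F)
          - X.1 * (F * F * F) := by
      simp only [mul_sub, sub_mul, mul_assoc]
      module
    rw [this, h2, h3, hF3]
    simp only [neg_mul, mul_neg]
    abel
  · apply Subtype.ext
    simp only [so_coe_lie, so_coe_add, so_coe_smul, ← hF]
    rw [signConj_coe, hD]
    have : (1 + (2 : ℂ) • (F * F)) * X.1 * (1 + (2 : ℂ) • (F * F))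
        = X.1 + (2 : ℂ) • (F * F * X.1) + (2 : ℂ) • (X.1 * F * F)
          + (4 : ℂ) • (F * F * X.1 * F * F) := by
      simp only [mul_add, add_mul, one_mul, mul_one, smul_mul_assoc, mul_smul_comm, mul_assoc]
      module
    rw [this, h4]
    have : F * (F * X.1 - X.1 * F) - (F * X.1 - X.1 * F) * F
        = F * F * X.1 - (2 : ℂ) • (F * X.1 * F) + X.1 * F * F := by
      simp only [mul_sub, sub_mul, mul_assoc]
      module
    rw [this, h1]
    module

/-! ### The opposition on an irreducible representation -/

section Representations

variable {V : Type u} [AddCommGroup V] [Module ℂ V] [LieRingModule (so n) V]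

theorem Intertwines.planeSign [LieModule ℂ (so n) V] [FiniteDimensional ℂ V]
    (hV : LieModule.IsIrreducible ℂ (so n) V)
    {p q : Idx n} (hpq : p ≠ q) : Intertwines V (OddOrthogonal.planeSign p q) := by
  obtain ⟨T, hT, hT'⟩ := exists_intertwiner hV (planeRotation p q)
    fun X => (planeRotation_identities hpq X).1
  exact ⟨T, hT, fun X v => by rw [hT', (planeRotation_identities hpq X).2]⟩

/-- Conjugation by `ε` is an involution acting as `-1` on the torus. -/
structure IsOpposition (ε : Idx n → ℂ) : Prop where
  mul_self : ε * ε = 1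
  mul_eq : ∀ i, ε (Sum.inl (Sum.inl i)) * ε (Sum.inl (Sum.inr i)) = -1

theorem exists_opposition [LieModule ℂ (so n) V] [FiniteDimensional ℂ V]
    (hV : LieModule.IsIrreducible ℂ (so n) V) :
    ∃ ε : Idx n → ℂ, IsOpposition ε ∧ Intertwines V ε := by
  -- Flipping one axis in each plane may have determinant `-1`, so each flip is paired with one of
  -- the last coordinate to give a rotation by `π`. The last coordinate ends up with the sign
  -- `(-1)^n`, which the torus does not see.
  refine ⟨∏ i : Fin n, planeSign (Sum.inl (Sum.inr i)) (Sum.inr ()), ⟨?_, ?_⟩, ?_⟩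
  · rw [← Finset.prod_mul_distrib]
    refine Finset.prod_eq_one fun i _ => ?_
    ext j
    simp only [Pi.mul_apply, planeSign, Pi.one_apply]
    split_ifs <;> norm_num
  · intro i
    rw [Finset.prod_apply, Finset.prod_apply]
    have h1 : ∏ j : Fin n, planeSign (Sum.inl (Sum.inr j)) (Sum.inr ())
        (Sum.inl (Sum.inl i) : Idx n) = 1 :=
      Finset.prod_eq_one fun j _ => by simp [planeSign]
    have h2 : ∏ j : Fin n, planeSign (Sum.inl (Sum.inr j)) (Sum.inr ())
        (Sum.inl (Sum.inr i) : Idx n) = -1 := by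
      rw [Finset.prod_eq_single i]
      · simp [planeSign]
      · intro j _ hj
        simp [planeSign, hj.symm]
      · simp
    rw [h1, h2, one_mul]
  · refine Finset.prod_induction _ (Intertwines V) (fun _ _ h h' => h.mul h') Intertwines.one ?_
    intro i _
    exact Intertwines.planeSign hV (by simp)

theorem IsOpposition.mem_rootSpace {ε : Idx n → ℂ} (hε : IsOpposition ε) {α : Functional n}
    {X : so n} (hX : X ∈ rootSpace α) : signConj ε X ∈ rootSpace (-α) := by
  intro ξ
  have h := congrArg (signConj ε) (hX ξ)
  rw [signConj_lie hε.mul_self, signConj_torusLie hε.mul_eq, signConj_smul, neg_lie] at h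
  rw [← neg_inj, h, LinearMap.neg_apply, Complex.ofReal_neg, mul_neg, neg_smul, neg_neg]

theorem exists_opposite_vector {ε : Idx n → ℂ} (hε : IsOpposition ε) (h : Intertwines V ε)
    {ω : Functional n} {s : Set (Functional n)} {v : V} (hv : v ≠ 0)
    (hw : ∀ ξ : Torus n, ⁅torusLie ξ, v⁆ = (Complex.I * (ω ξ : ℂ)) • v)
    (hs : ∀ α ∈ s, ∀ X ∈ rootSpace α, ⁅X, v⁆ = 0) :
    ∃ v' : V, v' ≠ 0 ∧ (∀ ξ : Torus n, ⁅torusLie ξ, v'⁆ = (Complex.I * ((-ω) ξ : ℂ)) • v') ∧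
      ∀ α ∈ s, ∀ X ∈ rootSpace (-α), ⁅X, v'⁆ = 0 := by
  obtain ⟨T, hT, hT'⟩ := h
  refine ⟨T v, fun h => hv (hT (by rw [h, map_zero])), fun ξ => ?_, fun α hα X hX => ?_⟩
  · have h := hT' (torusLie ξ) v
    rw [signConj_torusLie hε.mul_eq, hw, map_smul, neg_lie] at h
    rw [← neg_inj, ← h]
    simp
  · have h := hT' (signConj ε X) v
    rw [signConj_signConj, hε.mul_self, signConj_one] at h
    rw [← h, hs α hα _ (by simpa using hε.mem_rootSpace hX), map_zero]

theorem IsHighestWeight.neg {ε : Idx n → ℂ} (hε : IsOpposition ε) (h : Intertwines V ε)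
    {ω : Functional n} (hω : IsHighestWeight V ω) : IsLowestWeight V (-ω) := by
  obtain ⟨v, hv, hw, hs⟩ := hω
  exact exists_opposite_vector hε h hv hw hs

theorem IsLowestWeight.neg {ε : Idx n → ℂ} (hε : IsOpposition ε) (h : Intertwines V ε)
    {ω : Functional n} (hω : IsLowestWeight V ω) : IsHighestWeight V (-ω) := by
  obtain ⟨v, hv, hw, hs⟩ := hω
  obtain ⟨v', hv', hw', hs'⟩ := exists_opposite_vector (s := Neg.neg '' posRoots n) hε h hv hw
    (by rintro _ ⟨α, hα, rfl⟩; exact hs α hα)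
  exact ⟨v', hv', hw', fun α hα X hX => hs' (-α) ⟨α, hα, rfl⟩ X (by rwa [neg_neg])⟩

/-- If the highest weight is unique, then the uniton number is twice its value. -/
theorem unitonNumber_eq {ε : Idx n → ℂ} (hε : IsOpposition ε) (h : Intertwines V ε)
    {ω : Functional n} (hω : IsHighestWeight V ω) (huniq : ∀ ω', IsHighestWeight V ω' → ω' = ω)
    (ξ : Torus n) : unitonNumber V ξ = 2 * ω ξ := by
  have h1 : highestWeight V = ω := huniq _ (Classical.epsilon_spec ⟨ω, hω⟩)
  have h2 : IsLowestWeight V (lowestWeight V) := Classical.epsilon_spec ⟨-ω, hω.neg hε h⟩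
  have h3 : lowestWeight V = -ω := by rw [← huniq _ (h2.neg hε h), neg_neg]
  rw [unitonNumber, h1, h3, LinearMap.neg_apply]
  ring

/-! ### Uniqueness of the highest weight of an irreducible representation -/

variable [LieModule ℂ (so n) V]

/-- Lowering operators alone generate `V` from a highest weight vector. For the smallest
lowering-stable subspace `U` containing `v`, the vectors of `U` that all of the Lie algebra maps
into `U` again form a lowering-stable subspace containing `v`, by the Leibniz rule. By minimality
`U` is a submodule, hence everything. -/
theorem eq_top_of_lowering_stable (hV : LieModule.IsIrreducible ℂ (so n) V) {ω : Functional n}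
    {v : V} (hv : v ≠ 0) (hw : ∀ ξ : Torus n, ⁅torusLie ξ, v⁆ = (Complex.I * (ω ξ : ℂ)) • v)
    (hs : ∀ α ∈ posRoots n, ∀ X ∈ rootSpace α, ⁅X, v⁆ = 0) (W : Submodule ℂ V) (hvW : v ∈ W)
    (hW : ∀ α ∈ posRoots n, ∀ X ∈ rootSpace (-α), ∀ w ∈ W, ⁅X, w⁆ ∈ W) : W = ⊤ := by
  set C : Set (Submodule ℂ V) := {U | v ∈ U ∧
    ∀ α ∈ posRoots n, ∀ X ∈ rootSpace (-α), ∀ w ∈ U, ⁅X, w⁆ ∈ U} with hC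
  set U := sInf C with hU
  have hvU : v ∈ U := Submodule.mem_sInf.2 fun A hA => hA.1
  have hUs : ∀ α ∈ posRoots n, ∀ X ∈ rootSpace (-α), ∀ w ∈ U, ⁅X, w⁆ ∈ U :=
    fun α hα X hX w hw => Submodule.mem_sInf.2 fun A hA =>
      hA.2 α hα X hX w (Submodule.mem_sInf.1 hw A hA)
  let S : Submodule ℂ V :=
    { carrier := {w | w ∈ U ∧ ∀ X : so n, ⁅X, w⁆ ∈ U}
      add_mem' := fun {a b} ha hb => ⟨U.add_mem ha.1 hb.1, fun X => by
        rw [lie_add]; exact U.add_mem (ha.2 X) (hb.2 X)⟩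
      zero_mem' := ⟨U.zero_mem, fun X => by rw [lie_zero]; exact U.zero_mem⟩
      smul_mem' := fun c a ha => ⟨U.smul_mem c ha.1, fun X => by
        rw [lie_smul]; exact U.smul_mem c (ha.2 X)⟩ }
  have hvX : ∀ X : so n, ⁅X, v⁆ ∈ U := by
    intro X
    have hX : X ∈ Submodule.span ℂ
        (Set.range fun p : Idx n × Idx n => wedge (isoVec p.1) (isoVec p.2)) := by
      rw [span_wedge]; trivial
    induction hX using Submodule.span_induction with
    | mem x hx =>
      obtain ⟨⟨a, b⟩, rfl⟩ := hx
      rcases wedge_cases a b with h | h | ⟨-, c, ξ, h⟩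
      · rw [hs _ h _ (wedge_mem_rootSpace a b)]
        exact U.zero_mem
      · exact hUs _ h _ (by rw [neg_neg]; exact wedge_mem_rootSpace a b) v hvU
      · dsimp only
        rw [h, smul_lie, hw]
        exact U.smul_mem _ (U.smul_mem _ hvU)
    | zero => rw [zero_lie]; exact U.zero_mem
    | add x y _ _ hx hy => rw [add_lie]; exact U.add_mem hx hy
    | smul c x _ hx => rw [smul_lie]; exact U.smul_mem c hx
  have hSC : S ∈ C := by
    refine ⟨⟨hvU, hvX⟩, fun α hα Y hY w hw' => ⟨hUs α hα Y hY w hw'.1, fun X => ?_⟩⟩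
    rw [leibniz_lie]
    exact U.add_mem (hw'.2 _) (hUs α hα Y hY _ (hw'.2 X))
  have hUS : U ≤ S := sInf_le hSC
  let N : LieSubmodule ℂ (so n) V := { U with lie_mem := fun {X m} hm => (hUS hm).2 X }
  have hN : N = ⊤ := by
    refine (hV.eq_bot_or_eq_top N).resolve_left fun h => hv ?_
    have : v ∈ N := hvU
    rw [h] at this
    exact (LieSubmodule.mem_bot _).1 this
  have hUt : U = ⊤ := congrArg LieSubmodule.toSubmodule hN
  rw [eq_top_iff, ← hUt]
  exact sInf_le ⟨hvW, hW⟩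

/-- The eigenvectors of `ξ` with eigenvalue at most `ω ξ` span a lowering-stable subspace, since a
lowering operator subtracts `α ξ ≥ 0`. They therefore span `V`, and no other eigenvalue can occur.
-/
theorem weight_le_highestWeight (hV : LieModule.IsIrreducible ℂ (so n) V) {ω : Functional n}
    (hω : IsHighestWeight V ω) {ξ : Torus n} (hξ : ∀ α ∈ posRoots n, 0 ≤ α ξ) {v' : V}
    (hv' : v' ≠ 0) {c : ℝ} (hc : ⁅torusLie ξ, v'⁆ = (Complex.I * (c : ℂ)) • v') : c ≤ ω ξ := by
  obtain ⟨v, hv, hw, hs⟩ := hω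
  set P : Type u := {p : V × ULift.{u} ℝ // ⁅torusLie ξ, p.1⁆ = (Complex.I * (p.2.down : ℂ)) • p.1
    ∧ p.2.down ≤ ω ξ}
  have hspan : Submodule.span ℂ (Set.range fun p : P => p.1.1) = ⊤ := by
    refine eq_top_of_lowering_stable hV hv hw hs _
      (Submodule.subset_span ⟨⟨(v, ⟨ω ξ⟩), hw ξ, le_rfl⟩, rfl⟩) fun α hα X hX w hw' => ?_
    induction hw' using Submodule.span_induction with
    | mem x hx =>
      obtain ⟨⟨⟨x, d⟩, hd, hd'⟩, rfl⟩ := hx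
      refine Submodule.subset_span ⟨⟨(⁅X, x⁆, ⟨d.down - α ξ⟩), ?_, ?_⟩, rfl⟩
      · dsimp only at hd ⊢
        rw [lie_eigenvector (hX ξ) hd]
        congr 1
        push_cast [LinearMap.neg_apply]
        ring
      · have := hξ α hα
        dsimp only at hd' ⊢
        linarith
    | zero => rw [lie_zero]; exact Submodule.zero_mem _
    | add x y _ _ hx hy => rw [lie_add]; exact Submodule.add_mem _ hx hy
    | smul c x _ hx => rw [lie_smul]; exact Submodule.smul_mem _ c hx
  obtain ⟨p, hp, -⟩ := exists_eigenvalue_eq (LieModule.toEnd ℂ (so n) V (torusLie ξ))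
    (fun p : P => p.1.1) (fun p => Complex.I * (p.1.2.down : ℂ)) (fun p => p.2.1) hspan hc hv'
  have : p.1.2.down = c := by simpa using hp
  rw [← this]
  exact p.2.2

/-- A regular dominant element of the torus. -/
def regularElement (n : ℕ) : Torus n := fun j => (n : ℝ) - j.val

theorem nonneg_of_dominant {ξ : Torus n} (h : Antitone ξ) (h0 : ∀ i, 0 ≤ ξ i) {α : Functional n}
    (hα : α ∈ posRoots n) : 0 ≤ α ξ := by
  rcases hα with ⟨i, j, hij, rfl | rfl⟩ | ⟨i, rfl⟩
  · simpa [L] using h hij.le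
  · simpa [L] using add_nonneg (h0 i) (h0 j)
  · simpa [L] using h0 i

theorem functional_ext_of_dominant {ω ω' : Functional n}
    (h : ∀ ξ : Torus n, Antitone ξ → (∀ i, 0 ≤ ξ i) → ω ξ = ω' ξ) : ω = ω' := by
  have hreg : ∀ i j : Fin n, i < j → (i.val : ℝ) + 1 ≤ j.val := fun i j hij => by
    exact_mod_cast hij
  have hle : ∀ i : Fin n, (i.val : ℝ) + 1 ≤ n := fun i => by exact_mod_cast i.2
  have h1 := h (regularElement n)
    (fun i j hij => by
      have : (i.val : ℝ) ≤ j.val := by exact_mod_cast hij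
      simp only [regularElement]; linarith)
    (fun i => by have := hle i; simp only [regularElement]; linarith)
  refine LinearMap.pi_ext' fun i => LinearMap.ext_ring ?_
  -- Neighbouring coordinates of `regularElement n` differ by exactly `1`, so adding a unit vector
  -- keeps the element dominant. Differences of dominant elements thus give all basis vectors.
  have h2 := h (regularElement n + Pi.single i 1)
    (antitone_iff_forall_lt.2 fun j k hjk => by
      have := hreg j k hjk
      simp only [regularElement, Pi.add_apply, Pi.single_apply]
      split_ifs <;> linarith)
    (fun j => by
      have := hle j
      simp only [regularElement, Pi.add_apply, Pi.single_apply]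
      split_ifs <;> linarith)
  rw [map_add, map_add, h1] at h2
  simpa using h2

theorem highestWeight_unique (hV : LieModule.IsIrreducible ℂ (so n) V) {ω ω' : Functional n}
    (hω : IsHighestWeight V ω) (hω' : IsHighestWeight V ω') : ω' = ω := by
  refine functional_ext_of_dominant fun ξ h h0 => ?_
  obtain ⟨v, hv, hw, -⟩ := id hω
  obtain ⟨v', hv', hw', -⟩ := id hω'
  exact le_antisymm
    (weight_le_highestWeight hV hω (fun α hα => nonneg_of_dominant h h0 hα) hv' (hw' ξ))
    (weight_le_highestWeight hV hω' (fun α hα => nonneg_of_dominant h h0 hα) hv (hw ξ))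

theorem unitonNumber_fundamental {k : ℕ} (hV : IsFundamentalRep n k V) (ξ : Torus n) :
    unitonNumber V ξ = 2 * fundamentalWeight n k ξ := by
  have := hV.finiteDimensional
  obtain ⟨ε, hε, h⟩ := exists_opposition hV.irreducible
  exact unitonNumber_eq hε h hV.highestWeight
    (fun _ h' => highestWeight_unique hV.irreducible hV.highestWeight h') ξ

end Representations

/-! ### The standard and the adjoint representation -/

/-! ### Recognizing the highest weight without irreducibility -/

section Criteria

variable {V : Type u} [AddCommGroup V] [Module ℂ V] [LieRingModule (so n) V]

/-- A representation with a nondegenerate invariant form in which every vector is, modulo the image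
of the positive root spaces, a multiple of a fixed weight vector has a unique highest weight. -/
theorem highestWeight_unique_of_form (B : V →ₗ[ℂ] V →ₗ[ℂ] ℂ)
    (hB : ∀ (X : so n) (v w : V), B ⁅X, v⁆ w = -B v ⁅X, w⁆)
    (hnd : ∀ v, (∀ w, B v w = 0) → v = 0) (g : V) {ω₀ : Functional n}
    (hg : ∀ ξ : Torus n, ⁅torusLie ξ, g⁆ = (Complex.I * ((-ω₀) ξ : ℂ)) • g)
    (hs : ∀ R : Submodule ℂ V, g ∈ R →
      (∀ α ∈ posRoots n, ∀ X ∈ rootSpace α, ∀ w, ⁅X, w⁆ ∈ R) → R = ⊤)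
    {ω : Functional n} (hω : IsHighestWeight V ω) : ω = ω₀ := by
  obtain ⟨v, hv, hw, hk⟩ := hω
  -- Positive root vectors kill `v`, so by invariance `B v` vanishes on their images. If it also
  -- vanished on `g`, it would be zero.
  have hvg : B v g ≠ 0 := by
    intro h
    refine hv (hnd v fun w => ?_)
    have := hs (LinearMap.ker (B v)) h fun α hα X hX w => by
      rw [LinearMap.mem_ker, ← neg_eq_zero, ← hB, hk α hα X hX, map_zero, LinearMap.zero_apply]
    have hw : w ∈ LinearMap.ker (B v) := by rw [this]; trivial
    exact hw
  refine LinearMap.ext fun ξ => ?_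
  -- Invariance under the torus makes the weights of `v` and `g` opposite, because they pair
  -- nontrivially.
  have h := hB (torusLie ξ) v g
  rw [hw, hg, map_smul, map_smul, LinearMap.smul_apply, smul_eq_mul, smul_eq_mul, ← neg_mul] at h
  have h2 := mul_right_cancel₀ hvg h
  rw [LinearMap.neg_apply, Complex.ofReal_neg, mul_neg, neg_neg] at h2
  exact_mod_cast mul_left_cancel₀ Complex.I_ne_zero h2

theorem posRoot_regularElement {α : Functional n} (hα : α ∈ posRoots n) :
    0 < α (regularElement n) := by
  have hle : ∀ i : Fin n, (i.val : ℝ) + 1 ≤ n := fun i => by exact_mod_cast i.2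
  rcases hα with ⟨i, j, hij, rfl | rfl⟩ | ⟨i, rfl⟩
  · have : (i.val : ℝ) + 1 ≤ j.val := by exact_mod_cast hij
    simp only [L, regularElement, LinearMap.sub_apply, LinearMap.proj_apply]
    linarith
  · have := hle i
    have := hle j
    simp [L, regularElement]
    linarith
  · have := hle i
    simp [L, regularElement]

/-- A positive root vector strictly raises the eigenvalue of the regular element, and every
eigenvalue is attained by a nonzero member of the spanning family. A member with maximal eigenvalue
is therefore killed. -/
theorem isHighestWeight_of_spanning [LieModule ℂ (so n) V] {ι : Type*} (w : ι → V) (μ : ι → Functional n)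
    (hw : ∀ i (ξ : Torus n), ⁅torusLie ξ, w i⁆ = (Complex.I * (μ i ξ : ℂ)) • w i)
    (hs : Submodule.span ℂ (Set.range w) = ⊤) (i₀ : ι) (h0 : w i₀ ≠ 0)
    (hmax : ∀ i, w i ≠ 0 → μ i (regularElement n) ≤ μ i₀ (regularElement n)) :
    IsHighestWeight V (μ i₀) := by
  refine ⟨w i₀, h0, hw i₀, fun α hα X hX => ?_⟩
  by_contra hne
  obtain ⟨i, hi, hi'⟩ := exists_eigenvalue_eq
    (LieModule.toEnd ℂ (so n) V (torusLie (regularElement n))) w _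
    (fun i => hw i (regularElement n)) hs (lie_eigenvector (hX _) (hw i₀ _)) hne
  have h1 : μ i (regularElement n) = μ i₀ (regularElement n) + α (regularElement n) := by
    rw [← mul_add] at hi
    exact_mod_cast mul_left_cancel₀ Complex.I_ne_zero hi
  have := hmax i hi'
  have := posRoot_regularElement hα
  linarith

end Criteria

/-- The sign change at the partners of the first coordinates. -/
def partnerSign : Idx n → ℂ
  | Sum.inl (Sum.inr _) => -1
  | _ => 1

theorem isOpposition_partnerSign : IsOpposition (partnerSign (n := n)) := by
  refine ⟨?_, fun i => by simp [partnerSign]⟩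
  ext a
  rcases a with (i | i) | i <;> simp [partnerSign]

/-- The sign matrix itself is the intertwiner. It may have determinant `-1`, which is harmless:
conjugation by it still preserves the Lie algebra. -/
theorem intertwines_standard : Intertwines (n := n) (Standard n) partnerSign := by
  have hD : diagonal (partnerSign (n := n)) * diagonal partnerSign = 1 := by
    rw [diagonal_mul_diagonal']
    exact (congrArg diagonal isOpposition_partnerSign.mul_self).trans diagonal_one
  refine ⟨(diagonal partnerSign).mulVecLin, ?_, fun X v => ?_⟩
  · refine Function.LeftInverse.injective (g := (diagonal partnerSign).mulVecLin) fun v => ?_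
    rw [mulVecLin_apply, mulVecLin_apply, mulVec_mulVec, hD, one_mulVec]
  · rw [lie_standard, lie_standard, mulVecLin_apply, mulVecLin_apply, mulVec_mulVec, signConj_coe,
      mulVec_mulVec, mul_assoc, hD, mul_one]

theorem intertwines_adjoint : Intertwines (n := n) (Adjoint n) partnerSign := by
  refine ⟨⟨⟨signConj partnerSign, fun X Y => ?_⟩, fun c X => signConj_smul _ c X⟩, ?_, fun X v =>
    signConj_lie isOpposition_partnerSign.mul_self X v⟩
  · apply Subtype.ext
    simp only [signConj_coe, so_coe_add, mul_add, add_mul]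
  · refine Function.LeftInverse.injective (g := signConj partnerSign) fun X => ?_
    change signConj partnerSign (signConj partnerSign X) = X
    rw [signConj_signConj, isOpposition_partnerSign.mul_self, signConj_one]

theorem wedge_mulVec_isoVec (a b c : Idx n) :
    (wedge (isoVec a) (isoVec b)).1 *ᵥ isoVec c
      = (if c = dualIdx b then dualVal b else 0) • isoVec a
        - (if c = dualIdx a then dualVal a else 0) • isoVec b := by
  rw [wedge_mulVec, isoVec_dot, isoVec_dot]

theorem isoVec_ne_zero (a : Idx n) : isoVec a ≠ 0 := by
  intro h
  have := isoVec_dot a (dualIdx a)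
  rw [h, zero_dotProduct, if_pos rfl] at this
  rcases a with (i | i) | i <;> norm_num [dualVal] at this

theorem standard_weight (a : Idx n) (ξ : Torus n) :
    ⁅torusLie ξ, (isoVec a : Standard n)⁆ = (Complex.I * (wt a ξ : ℂ)) • isoVec a :=
  torusMatrix_mulVec_isoVec ξ a

/-- The first index. -/
abbrev fstIdx (hn : 1 ≤ n) : Fin n := ⟨0, hn⟩

theorem fstIdx_lt {hn : 1 ≤ n} {i : Fin n} (h : i ≠ fstIdx hn) : fstIdx hn < i := by
  rw [Fin.lt_def]
  exact Nat.pos_of_ne_zero fun h' => h (Fin.ext h')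

theorem wt_add_mem_posRoots {i : Fin n} {b : Idx n}
    (hb : ∀ j, b = Sum.inl (Sum.inl j) ∨ b = Sum.inl (Sum.inr j) → i < j) :
    wt (Sum.inl (Sum.inl i)) + wt b ∈ posRoots n := by
  rcases b with (j | j) | j
  · exact Or.inl ⟨i, j, hb j (Or.inl rfl), Or.inr rfl⟩
  · exact Or.inl ⟨i, j, hb j (Or.inr rfl), Or.inl (by simp [wt, sub_eq_add_neg])⟩
  · exact Or.inr ⟨i, by simp [wt]⟩

theorem fst_add_mem_posRoots (hn : 1 ≤ n) {b : Idx n} (h : b ≠ Sum.inl (Sum.inl (fstIdx hn)))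
    (h' : b ≠ Sum.inl (Sum.inr (fstIdx hn))) :
    wt (Sum.inl (Sum.inl (fstIdx hn))) + wt b ∈ posRoots n := by
  refine wt_add_mem_posRoots fun j hj => fstIdx_lt ?_
  rintro rfl
  exact hj.elim h h'

theorem wt_regularElement_le (a : Idx n) : wt a (regularElement n) ≤ n := by
  rcases a with (i | i) | i <;> simp [wt, L, regularElement]
  have : (i.val : ℝ) + 1 ≤ n := by exact_mod_cast i.2
  linarith

theorem isHighestWeight_standard (hn : 1 ≤ n) : IsHighestWeight (Standard n) (L (fstIdx hn)) :=
  isHighestWeight_of_spanning (V := Standard n) isoVec wt standard_weight span_isoVec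
    (Sum.inl (Sum.inl (fstIdx hn))) (isoVec_ne_zero _) fun a _ =>
      (wt_regularElement_le a).trans (by simp [wt, L, regularElement])

theorem highestWeight_standard_unique (hn : 1 ≤ n) {ω : Functional n}
    (hω : IsHighestWeight (Standard n) ω) : ω = L (fstIdx hn) := by
  set p : Idx n := Sum.inl (Sum.inl (fstIdx hn)) with hp
  set p' : Idx n := Sum.inl (Sum.inr (fstIdx hn)) with hp'
  refine highestWeight_unique_of_form (V := Standard n) (dotProductBilin ℂ ℂ) ?_ ?_
    (isoVec p') (fun ξ => standard_weight p' ξ) ?_ hω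
  · intro X v w
    rw [lie_standard, lie_standard]
    change X.1 *ᵥ v ⬝ᵥ w = -(v ⬝ᵥ X.1 *ᵥ w)
    rw [dotProduct_mulVec, ← mulVec_transpose, so_transpose, neg_mulVec, neg_dotProduct, neg_neg]
  · intro v hv
    exact dotProduct_eq_zero v hv
  · intro R hg hR
    have h1 : ∀ b, b ≠ p → isoVec b ∈ R := by
      intro b hb
      by_cases hb' : b = p'
      · rw [hb']; exact hg
      -- The positive root vector `p ∧ b` sends the lowest vector `p'` to `-2 b`.
      · have h := hR _ (fst_add_mem_posRoots hn hb hb') _ (wedge_mem_rootSpace _ _) (isoVec p')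
        rw [lie_standard, wedge_mulVec_isoVec, if_neg, if_pos (show p' = dualIdx p from rfl),
          zero_smul, zero_sub] at h
        · have h2 := R.smul_mem (-(1 / 2)) h
          simpa [dualVal, smul_smul] using h2
        · intro h3
          apply hb
          rcases b with (j | j) | j <;> simp_all [dualIdx]
    -- The root vector `p ∧ z`, with `z` the last coordinate, sends `z` to `p`.
    have h2 : isoVec p ∈ R := by
      have h := hR _ (fst_add_mem_posRoots hn (b := Sum.inr ()) (by simp) (by simp)) _
        (wedge_mem_rootSpace _ _) (isoVec (Sum.inr ()))
      rw [lie_standard, wedge_mulVec_isoVec, if_pos (show Sum.inr () = dualIdx (Sum.inr ()) from rfl),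
        if_neg (by simp [dualIdx])] at h
      simpa [dualVal] using h
    rw [eq_top_iff, ← span_isoVec, Submodule.span_le]
    rintro _ ⟨b, rfl⟩
    by_cases hb : b = p
    · rw [hb]; exact h2
    · exact h1 b hb

theorem unitonNumber_standard (hn : 1 ≤ n) (ξ : Torus n) :
    unitonNumber (Standard n) ξ = 2 * ξ (fstIdx hn) :=
  unitonNumber_eq isOpposition_partnerSign intertwines_standard (isHighestWeight_standard hn)
    (fun _ h => highestWeight_standard_unique hn h) ξ

/-- The trace form. -/
noncomputable def traceForm (n : ℕ) : Adjoint n →ₗ[ℂ] Adjoint n →ₗ[ℂ] ℂ :=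
  LinearMap.mk₂ ℂ (fun X Y => (X.1 * Y.1).trace)
    (fun X Y Z => by rw [so_coe_add, add_mul, trace_add])
    (fun c X Y => by rw [so_coe_smul, smul_mul_assoc, trace_smul])
    (fun X Y Z => by rw [so_coe_add, mul_add, trace_add])
    (fun c X Y => by rw [so_coe_smul, mul_smul_comm, trace_smul])

theorem traceForm_apply (X Y : Adjoint n) : traceForm n X Y = (X.1 * Y.1).trace := rfl

theorem traceForm_invariant (X : so n) (Y Z : Adjoint n) :
    traceForm n ⁅X, Y⁆ Z = -traceForm n Y ⁅X, Z⁆ := by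
  rw [traceForm_apply, traceForm_apply, so_coe_lie, so_coe_lie, sub_mul, mul_sub, trace_sub,
    trace_sub, mul_assoc X.1, trace_mul_comm X.1, mul_assoc, mul_assoc]
  ring

theorem traceForm_nondegenerate (X : Adjoint n) (h : ∀ Y, traceForm n X Y = 0) : X = 0 := by
  apply Subtype.ext
  ext i j
  have hX : X.1 j i = -X.1 i j := congrFun (congrFun (so_transpose X) i) j
  have := h (wedge (Pi.single j 1) (Pi.single i 1))
  rw [traceForm_apply, wedge_coe, mul_sub, trace_sub, mul_vecMulVec, mul_vecMulVec,
    trace_vecMulVec, trace_vecMulVec] at this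
  simp [hX] at this
  exact this

/-- A space containing the image of the positive root spaces and the vectors of weight
`-L₁ + wt b` contains the whole adjoint representation. -/
theorem adjoint_eq_top (hn : 1 ≤ n) (R : Submodule ℂ (Adjoint n))
    (hR : ∀ α ∈ posRoots n, ∀ X ∈ rootSpace α, ∀ w : Adjoint n, ⁅X, w⁆ ∈ R)
    (hR' : ∀ b : Idx n, b ≠ Sum.inl (Sum.inl (fstIdx hn)) → b ≠ Sum.inl (Sum.inr (fstIdx hn)) →
      wedge (isoVec (Sum.inl (Sum.inr (fstIdx hn)))) (isoVec b) ∈ R) : R = ⊤ := by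
  set p : Idx n := Sum.inl (Sum.inl (fstIdx hn)) with hp
  set p' : Idx n := Sum.inl (Sum.inr (fstIdx hn)) with hp'
  set z : Idx n := Sum.inr () with hz
  have hdp : dualIdx p = p' := rfl
  have hdz : dualIdx z = z := rfl
  have hvp : dualVal p = 2 := rfl
  have hvz : dualVal z = 1 := rfl
  have hzp : z ≠ p := by simp [hz, hp]
  have hzp' : z ≠ p' := by simp [hz, hp']
  have hpp' : p ≠ p' := by simp [hp, hp']
  have hd : ∀ b, b ≠ p → p' ≠ dualIdx b := by
    rintro ((j | j) | j) hb h <;> simp_all [dualIdx]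
  have hlie : ∀ b, b ≠ p → b ≠ p' → ∀ x y : Idx n → ℂ,
      wedge ((wedge (isoVec p) (isoVec b)).1 *ᵥ x) y
        + wedge x ((wedge (isoVec p) (isoVec b)).1 *ᵥ y) ∈ R := by
    intro b hb hb' x y
    rw [← lie_wedge]
    exact hR _ (fst_add_mem_posRoots hn hb hb') _ (wedge_mem_rootSpace _ _) _
  have hsw : ∀ {x y : Idx n → ℂ}, wedge x y ∈ R → wedge y x ∈ R := by
    intro x y h
    rw [wedge_swap]
    exact R.neg_mem h
  -- `[p ∧ z, p' ∧ z] = p' ∧ p`, since the other term is a multiple of `z ∧ z`.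
  have h1 : wedge (isoVec p') (isoVec p) ∈ R := by
    have h := hlie z hzp hzp' (isoVec p') (isoVec z)
    rw [wedge_mulVec_isoVec, wedge_mulVec_isoVec, hdz, hdp, if_neg hzp'.symm, if_pos rfl,
      if_pos rfl, if_neg hzp'] at h
    simpa [wedge_smul_left, hvp, hvz, wedge_self, ← neg_smul] using h
  -- `[p ∧ a, p' ∧ b]` is `-2 a ∧ b` plus a multiple of `p' ∧ p`.
  have h2 : ∀ a b, a ≠ p → a ≠ p' → b ≠ p → b ≠ p' → wedge (isoVec a) (isoVec b) ∈ R := by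
    intro a b ha ha' hb hb'
    have h := hlie a ha ha' (isoVec p') (isoVec b)
    rw [wedge_mulVec_isoVec, wedge_mulVec_isoVec, hdp, if_neg (hd a ha), if_pos rfl,
      if_neg hb'] at h
    simp only [zero_smul, zero_sub, sub_zero, ← neg_smul, wedge_smul_left,
      wedge_smul_right] at h
    have h' := (R.add_mem_iff_left (R.smul_mem _ h1)).1 h
    exact (R.smul_mem_iff (by rw [hvp]; norm_num)).1 h'
  -- `[p ∧ z, p' ∧ p] = -2 z ∧ p` settles `b = z`, and `[p ∧ z, z ∧ b] = p ∧ b` the other cases.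
  have h3 : ∀ b, b ≠ p → b ≠ p' → wedge (isoVec p) (isoVec b) ∈ R := by
    intro b hb hb'
    by_cases hbz : b = z
    · have h := hlie z hzp hzp' (isoVec p') (isoVec p)
      rw [wedge_mulVec_isoVec, wedge_mulVec_isoVec, hdp, hdz, if_neg hzp'.symm, if_pos rfl,
        if_neg hzp.symm, if_neg hpp'] at h
      simp only [zero_smul, zero_sub, sub_zero, wedge_zero_right, add_zero] at h
      rw [← neg_smul, wedge_smul_left] at h
      rw [hbz]
      exact hsw ((R.smul_mem_iff (by rw [hvp]; norm_num)).1 h)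
    · have h := hlie z hzp hzp' (isoVec z) (isoVec b)
      rw [wedge_mulVec_isoVec, wedge_mulVec_isoVec, hdp, hdz, if_pos rfl, if_neg hzp',
        if_neg hbz, if_neg hb', hvz] at h
      simpa only [zero_smul, one_smul, sub_zero, wedge_zero_right, add_zero] using h
  have h4 : ∀ a b : Idx n, wedge (isoVec a) (isoVec b) ∈ R := by
    intro a b
    by_cases hab : a = b
    · rw [hab, wedge_self]; exact R.zero_mem
    by_cases ha : a = p
    · subst ha
      by_cases hb : b = p'
      · rw [hb]; exact hsw h1
      · exact h3 b (Ne.symm hab) hb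
    by_cases ha' : a = p'
    · subst ha'
      by_cases hb : b = p
      · rw [hb]; exact h1
      · exact hR' b hb (Ne.symm hab)
    by_cases hb : b = p
    · rw [hb]; exact hsw (h3 a ha ha')
    by_cases hb' : b = p'
    · rw [hb']; exact hsw (hR' a ha ha')
    exact h2 a b ha ha' hb hb'
  rw [eq_top_iff, ← span_wedge, Submodule.span_le]
  rintro _ ⟨⟨a, b⟩, rfl⟩
  exact h4 a b

/-- The second index. -/
abbrev sndIdx (hn : 2 ≤ n) : Fin n := ⟨1, hn⟩

theorem isHighestWeight_adjoint (hn : 2 ≤ n) :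
    IsHighestWeight (Adjoint n) (L (fstIdx (Nat.one_le_of_lt hn)) + L (sndIdx hn)) := by
  refine isHighestWeight_of_spanning (V := Adjoint n)
    (fun p : Idx n × Idx n => wedge (isoVec p.1) (isoVec p.2)) (fun p => wt p.1 + wt p.2)
    (fun p ξ => torusLie_lie_wedge ξ p.1 p.2) span_wedge
    (Sum.inl (Sum.inl (fstIdx (Nat.one_le_of_lt hn))), Sum.inl (Sum.inl (sndIdx hn)))
    (wedge_isoVec_ne_zero (by simp)) ?_
  rintro ⟨a, b⟩ h
  have hab : a ≠ b := fun hab => h (by rw [hab, wedge_self])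
  have hn' : (2 : ℝ) ≤ n := by exact_mod_cast hn
  have hle : ∀ i : Fin n, (i.val : ℝ) + 1 ≤ n := fun i => by exact_mod_cast i.2
  rcases a with (i | i) | i <;> rcases b with (j | j) | j <;>
    simp [wt, L, regularElement]
  · have : 1 ≤ i.val + j.val := by
      by_contra h0
      exact hab (congrArg _ (congrArg _ (Fin.ext (by omega))))
    have : (1 : ℝ) ≤ i.val + j.val := by exact_mod_cast this
    linarith
  · have := hle i; have := hle j; have : (0 : ℝ) ≤ i.val := by positivity
    linarith
  · have := hle i; have : (0 : ℝ) ≤ i.val := by positivity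
    linarith
  · have := hle i; have := hle j; have : (0 : ℝ) ≤ j.val := by positivity
    linarith
  · have := hle i; have := hle j
    linarith
  · have := hle i
    linarith
  · have : (0 : ℝ) ≤ j.val := by positivity
    linarith
  · have := hle j
    linarith
  · linarith

/-- The lowest vector is `p' ∧ q'`. The hypotheses of `adjoint_eq_top` come from `[q ∧ z, p' ∧ z] =
p' ∧ q` and `[q ∧ b, p' ∧ q'] = -2 p' ∧ b`. -/
theorem highestWeight_adjoint_unique (hn : 2 ≤ n) {ω : Functional n}
    (hω : IsHighestWeight (Adjoint n) ω) :
    ω = L (fstIdx (Nat.one_le_of_lt hn)) + L (sndIdx hn) := by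
  set p : Idx n := Sum.inl (Sum.inl (fstIdx (Nat.one_le_of_lt hn))) with hp
  set p' : Idx n := Sum.inl (Sum.inr (fstIdx (Nat.one_le_of_lt hn))) with hp'
  set q : Idx n := Sum.inl (Sum.inl (sndIdx hn)) with hq
  set q' : Idx n := Sum.inl (Sum.inr (sndIdx hn)) with hq'
  set z : Idx n := Sum.inr () with hz
  refine highestWeight_unique_of_form (V := Adjoint n) (traceForm n) traceForm_invariant
    traceForm_nondegenerate (wedge (isoVec p') (isoVec q')) ?_ ?_ hω
  · intro ξ
    rw [torusLie_lie_wedge]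
    congr 4
    simp [wt, hp', hq', add_comm]
  · intro R hg hR
    refine adjoint_eq_top (Nat.one_le_of_lt hn) R hR fun b hb hb' => ?_
    have hdq : dualIdx q = q' := rfl
    have hdz : dualIdx z = z := rfl
    have hqp : p' ≠ q' := by simp [hp', hq']
    have hlie : ∀ b, b ≠ p → b ≠ p' → b ≠ q → b ≠ q' → ∀ x y : Idx n → ℂ,
        wedge ((wedge (isoVec q) (isoVec b)).1 *ᵥ x) y
          + wedge x ((wedge (isoVec q) (isoVec b)).1 *ᵥ y) ∈ R := by
      intro b h1 h2 h3 h4 x y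
      rw [← lie_wedge]
      refine hR _ (wt_add_mem_posRoots fun j hj => ?_) _ (wedge_mem_rootSpace _ _) _
      rw [Fin.lt_def]
      by_contra h
      have : j.val = 0 ∨ j.val = 1 := by
        have : j.val ≤ 1 := not_lt.1 h
        omega
      rcases this with h0 | h0
      · have : j = fstIdx (Nat.one_le_of_lt hn) := Fin.ext h0
        rw [this] at hj
        exact hj.elim h1 h2
      · have : j = sndIdx hn := Fin.ext h0
        rw [this] at hj
        exact hj.elim h3 h4
    by_cases h1 : b = q'
    · rw [h1]; exact hg
    by_cases h2 : b = q
    · have h := hlie z (by simp [hz, hp]) (by simp [hz, hp']) (by simp [hz, hq])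
        (by simp [hz, hq']) (isoVec p') (isoVec z)
      rw [wedge_mulVec_isoVec, wedge_mulVec_isoVec, hdz, hdq, if_neg (by simp [hz, hp']),
        if_neg hqp, if_pos rfl, if_neg (by simp [hz, hq'])] at h
      rw [h2]
      simpa [wedge_zero_left, show dualVal z = 1 from rfl] using h
    · have hd : q' ≠ dualIdx b := by
        intro h
        apply h2
        rcases b with (j | j) | j <;> simp_all [dualIdx]
      have hd' : p' ≠ dualIdx b := by
        intro h
        apply hb
        rcases b with (j | j) | j <;> simp_all [dualIdx]
      have h := hlie b hb hb' h2 h1 (isoVec p') (isoVec q')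
      rw [wedge_mulVec_isoVec, wedge_mulVec_isoVec, hdq, if_neg hd', if_neg hqp, if_neg hd,
        if_pos rfl] at h
      simp only [zero_smul, sub_zero, wedge_zero_left, zero_add, zero_sub] at h
      rw [← neg_smul, wedge_smul_right] at h
      exact (R.smul_mem_iff (by simp [dualVal, hq])).1 h

theorem unitonNumber_adjoint (hn : 2 ≤ n) (ξ : Torus n) :
    unitonNumber (Adjoint n) ξ = 2 * (ξ (fstIdx (Nat.one_le_of_lt hn)) + ξ (sndIdx hn)) :=
  unitonNumber_eq isOpposition_partnerSign intertwines_adjoint (isHighestWeight_adjoint hn)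
    (fun _ h => highestWeight_adjoint_unique hn h) ξ

/-- With only one rotation plane there is no root `L₁ + L₂`; the highest root is `L₁`. -/
theorem isHighestWeight_adjoint_one :
    IsHighestWeight (Adjoint 1) (L (fstIdx le_rfl)) := by
  have h : (L (fstIdx le_rfl) : Functional 1)
      = wt (Sum.inl (Sum.inl (fstIdx le_rfl))) + wt (Sum.inr ()) := by simp [wt]
  rw [h]
  refine isHighestWeight_of_spanning (V := Adjoint 1)
    (fun p : Idx 1 × Idx 1 => wedge (isoVec p.1) (isoVec p.2)) (fun p => wt p.1 + wt p.2)
    (fun p ξ => torusLie_lie_wedge ξ p.1 p.2) span_wedge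
    (Sum.inl (Sum.inl (fstIdx le_rfl)), Sum.inr ()) (wedge_isoVec_ne_zero (by simp)) ?_
  rintro ⟨a, b⟩ h
  have hab : a ≠ b := fun hab => h (by rw [hab, wedge_self])
  rcases a with (i | i) | i <;> rcases b with (j | j) | j <;>
    simp [wt, L, regularElement]
  · exact absurd (congrArg _ (congrArg _ (Subsingleton.elim i j))) hab
  · norm_num

theorem highestWeight_adjoint_one_unique {ω : Functional 1}
    (hω : IsHighestWeight (Adjoint 1) ω) : ω = L (fstIdx le_rfl) := by
  refine highestWeight_unique_of_form (V := Adjoint 1) (traceForm 1) traceForm_invariant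
    traceForm_nondegenerate
    (wedge (isoVec (Sum.inl (Sum.inr (fstIdx le_rfl)))) (isoVec (Sum.inr ()))) ?_ ?_ hω
  · intro ξ
    rw [torusLie_lie_wedge]
    simp [wt]
  · intro R hg hR
    refine adjoint_eq_top le_rfl R hR fun b hb hb' => ?_
    rcases b with (j | j) | j
    · exact absurd (congrArg _ (congrArg _ (Subsingleton.elim _ _))) hb
    · exact absurd (congrArg _ (congrArg _ (Subsingleton.elim _ _))) hb'
    · exact hg

theorem unitonNumber_adjoint_one (ξ : Torus 1) :
    unitonNumber (Adjoint 1) ξ = 2 * ξ (fstIdx le_rfl) :=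
  unitonNumber_eq isOpposition_partnerSign intertwines_adjoint isHighestWeight_adjoint_one
    (fun _ h => highestWeight_adjoint_one_unique h) ξ

/-! ### The exponential on the torus -/

/-- The matrix whose columns are the isotropic basis. -/
noncomputable def isoMatrix (n : ℕ) : Matrix (Idx n) (Idx n) ℂ := of fun i a => isoVec a i

theorem isoMatrix_mulVec (M : Matrix (Idx n) (Idx n) ℂ) (i a : Idx n) :
    (M * isoMatrix n) i a = (M *ᵥ isoVec a) i := rfl

theorem isUnit_isoMatrix : IsUnit (isoMatrix n) := by
  rw [← mulVec_surjective_iff_isUnit]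
  have h : LinearMap.range (isoMatrix n).mulVecLin = ⊤ := by
    rw [range_mulVecLin, ← span_isoVec]
    rfl
  exact LinearMap.range_eq_top.1 h

theorem exp_smul_torusMatrix (c : ℂ) (ξ : Torus n) :
    NormedSpace.exp (c • torusMatrix ξ) = isoMatrix n *
      diagonal (fun a => Complex.exp (c * (Complex.I * (wt a ξ : ℝ)))) * (isoMatrix n)⁻¹ := by
  have hdet : IsUnit (isoMatrix n).det := (isUnit_iff_isUnit_det _).1 isUnit_isoMatrix
  have h : c • torusMatrix ξ = isoMatrix n *
      diagonal (fun a => c * (Complex.I * (wt a ξ : ℝ))) * (isoMatrix n)⁻¹ := by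
    have : c • torusMatrix ξ * isoMatrix n
        = isoMatrix n * diagonal (fun a => c * (Complex.I * (wt a ξ : ℝ))) := by
      ext i a
      rw [isoMatrix_mulVec, smul_mulVec, torusMatrix_mulVec_isoVec, mul_diagonal]
      simp only [isoMatrix, of_apply, Pi.smul_apply, smul_eq_mul]
      ring
    rw [← this, mul_nonsing_inv_cancel_right _ _ hdet]
  rw [h, exp_conj _ _ isUnit_isoMatrix, exp_diagonal]
  congr 3
  ext a
  rw [Pi.coe_exp, Complex.exp_eq_exp_ℂ]

theorem exp_smul_torusMatrix_eq_one_iff (c : ℂ) (ξ : Torus n) :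
    NormedSpace.exp (c • torusMatrix ξ) = 1 ↔
      ∀ a : Idx n, Complex.exp (c * (Complex.I * (wt a ξ : ℝ))) = 1 := by
  have hdet : IsUnit (isoMatrix n).det := (isUnit_iff_isUnit_det _).1 isUnit_isoMatrix
  rw [exp_smul_torusMatrix]
  constructor
  · intro h a
    have h2 : isoMatrix n * diagonal (fun a => Complex.exp (c * (Complex.I * (wt a ξ : ℝ))))
        = isoMatrix n * 1 := by
      have := congrArg (· * isoMatrix n) h
      simpa [nonsing_inv_mul_cancel_right _ _ hdet] using this
    have h3 := isUnit_isoMatrix.mul_left_cancel h2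
    have := congrFun (congrFun h3 a) a
    simpa using this
  · intro h
    have : diagonal (fun a : Idx n => Complex.exp (c * (Complex.I * (wt a ξ : ℝ)))) = 1 := by
      rw [← diagonal_one]
      congr 1
      ext a
      exact h a
    rw [this, mul_one, mul_nonsing_inv _ hdet]

/-- One criterion serves both lattices: `r = 2` gives integral coordinates and `r = 1` even ones. -/
theorem exp_torus_eq_one_iff (r : ℝ) (ξ : Torus n) :
    NormedSpace.exp (((r * Real.pi : ℝ) : ℂ) • torusMatrix ξ) = 1 ↔
      ∀ i, ∃ k : ℤ, r * ξ i = 2 * k := by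
  have key : ∀ x : ℝ, Complex.exp (((r * Real.pi : ℝ) : ℂ) * (Complex.I * (x : ℝ))) = 1 ↔
      ∃ k : ℤ, r * x = 2 * k := by
    intro x
    rw [Complex.exp_eq_one_iff]
    refine exists_congr fun k => ?_
    have hpi : (Real.pi : ℂ) ≠ 0 := by exact_mod_cast Real.pi_ne_zero
    constructor
    · intro h
      have h2 : ((r * x : ℝ) : ℂ) = ((2 * k : ℝ) : ℂ) := by
        push_cast at h ⊢
        refine mul_right_cancel₀ (mul_ne_zero hpi Complex.I_ne_zero) ?_
        linear_combination h
      exact_mod_cast h2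
    · intro h
      have h2 : ((r * x : ℝ) : ℂ) = ((2 * k : ℝ) : ℂ) := by rw [h]
      push_cast at h2 ⊢
      linear_combination (Real.pi * Complex.I : ℂ) * h2
  rw [exp_smul_torusMatrix_eq_one_iff]
  simp only [key]
  constructor
  · intro h i
    exact h (Sum.inl (Sum.inl i))
  · rintro h ((i | i) | i)
    · exact h i
    · obtain ⟨k, hk⟩ := h i
      refine ⟨-k, ?_⟩
      simp only [wt, L, LinearMap.neg_apply, LinearMap.proj_apply]
      push_cast
      linarith
    · exact ⟨0, by simp [wt]⟩

theorem mem_integerLattice_iff {ξ : Torus n} :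
    ξ ∈ integerLattice n ↔ ∀ i, ∃ k : ℤ, ξ i = k := by
  have h := exp_torus_eq_one_iff 2 ξ
  rw [integerLattice, Set.mem_ofPred_eq]
  push_cast at h
  rw [h]
  simp

theorem mem_evenLattice_iff {ξ : Torus n} :
    ξ ∈ evenLattice n ↔ ∀ i, ∃ k : ℤ, ξ i = 2 * k := by
  have h := exp_torus_eq_one_iff 1 ξ
  rw [evenLattice, Set.mem_ofPred_eq]
  simp only [one_mul] at h
  exact h

/-- The eigenvalues of `exp (π ξ)` for `ξ` with integral coordinates `a`. -/
def paritySign (a : Fin n → ℤ) : Idx n → ℝ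
  | Sum.inl (Sum.inl i) => if Even (a i) then 1 else -1
  | Sum.inl (Sum.inr i) => if Even (a i) then 1 else -1
  | Sum.inr _ => 1

theorem exp_pi_mul_int (k : ℤ) :
    Complex.exp (Real.pi * (Complex.I * (k : ℝ))) = ((if Even k then 1 else -1 : ℝ) : ℂ) := by
  have h : (Real.pi * (Complex.I * (k : ℝ)) : ℂ) = k * (Real.pi * Complex.I) := by
    push_cast
    ring
  rw [h, Complex.exp_int_mul, Complex.exp_pi_mul_I]
  split_ifs with hk
  · rw [hk.neg_one_zpow]; simp
  · rw [(Int.not_even_iff_odd.1 hk).neg_one_zpow]; simp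

theorem loop_neg_one {ξ : Torus n} {a : Fin n → ℤ} (h : ∀ i, ξ i = a i) :
    loop ξ (-1) = (diagonal (paritySign a)).map (fun x : ℝ => (x : ℂ)) := by
  have hdet : IsUnit (isoMatrix n).det := (isUnit_iff_isUnit_det _).1 isUnit_isoMatrix
  have h1 : (-Complex.I * Complex.log (-1)) = Real.pi := by
    rw [Complex.log_neg_one]
    linear_combination (-Real.pi : ℂ) * Complex.I_mul_I
  have h2 : (fun b : Idx n => Complex.exp (Real.pi * (Complex.I * (wt b ξ : ℝ))))
      = fun b => ((paritySign a b : ℝ) : ℂ) := by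
    ext b
    rcases b with (i | i) | i
    · simp only [wt, L, LinearMap.proj_apply, h, exp_pi_mul_int, paritySign]
    · have := exp_pi_mul_int (-(a i))
      simp only [even_neg, Int.cast_neg] at this
      simp only [wt, L, LinearMap.neg_apply, LinearMap.proj_apply, h, paritySign]
      exact this
    · simp [wt, paritySign]
  have h3 : (diagonal (paritySign a)).map (fun x : ℝ => (x : ℂ)) =
      diagonal fun b => ((paritySign a b : ℝ) : ℂ) := by
    rw [diagonal_map (by simp)]
  rw [loop, h1, exp_smul_torusMatrix, h2, h3]
  -- For integral coordinates the two eigenvalues on each rotation plane coincide, so the diagonal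
  -- matrix commutes with the change of basis inside that plane.
  have h4 : isoMatrix n * diagonal (fun b => ((paritySign a b : ℝ) : ℂ))
      = diagonal (fun b => ((paritySign a b : ℝ) : ℂ)) * isoMatrix n := by
    ext b c
    rw [mul_diagonal, diagonal_mul]
    rcases b with (i | i) | i <;> rcases c with (j | j) | j <;>
      by_cases hij : i = j <;>
      simp [isoMatrix, isoVec, paritySign, hij, mul_comm]
  rw [h4, mul_nonsing_inv_cancel_right _ _ hdet]

/-! ### The partial order on the dominant lattice -/

theorem wt_int {ξ : Torus n} (h : ξ ∈ integerLattice n) (a : Idx n) : ∃ k : ℤ, wt a ξ = k := by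
  rw [mem_integerLattice_iff] at h
  rcases a with (i | i) | i
  · exact h i
  · obtain ⟨k, hk⟩ := h i
    exact ⟨-k, by simp [wt, L, hk]⟩
  · exact ⟨0, by simp [wt]⟩

theorem mem_adEigenspace {ξ : Torus n} {j : ℤ} {X : so n} :
    X ∈ adEigenspace ξ j ↔ ⁅torusLie ξ, X⁆ = (Complex.I * (j : ℂ)) • X :=
  Module.End.mem_eigenspace_iff

/-- An eigenvector of `ad ξ` is a combination of wedges with the same eigenvalue, so it is enough to
bound the `ξ'`-eigenvalue of each. Positive roots use the hypothesis; negative roots and the torus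
give values `≤ 0 ≤ i`. -/
theorem precedes_of_le {ξ ξ' : Torus n} (hξ' : ξ' ∈ dominantLattice n)
    (h : ∀ α ∈ posRoots n, α ξ' ≤ α ξ) : Precedes ξ ξ' := by
  intro i hi
  refine iSup_le fun j => iSup_le fun hj => fun X hX => ?_
  have hX' := mem_span_of_eigenvector (LieAlgebra.ad ℂ (so n) (torusLie ξ))
    (fun p : Idx n × Idx n => wedge (isoVec p.1) (isoVec p.2))
    (fun p => Complex.I * (((wt p.1 + wt p.2) ξ : ℝ) : ℂ))
    (fun p => torusLie_lie_wedge ξ p.1 p.2) span_wedge (mem_adEigenspace.1 hX)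
  refine (Submodule.span_le.2 ?_ : _ ≤ parabolic ξ' i) hX'
  rintro _ ⟨⟨a, b⟩, hab, rfl⟩
  have hab' : (wt a + wt b) ξ = j := by
    exact_mod_cast mul_left_cancel₀ Complex.I_ne_zero hab
  have hjr : (j : ℝ) ≤ i := by exact_mod_cast hj
  have hir : (0 : ℝ) ≤ i := by exact_mod_cast hi
  by_cases heq : a = b
  · simp only [heq, wedge_self]
    exact Submodule.zero_mem _
  obtain ⟨k₁, hk₁⟩ := wt_int hξ'.1 a
  obtain ⟨k₂, hk₂⟩ := wt_int hξ'.1 b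
  have hle : (wt a + wt b) ξ' ≤ i := by
    rcases wedge_cases a b with h1 | h1 | ⟨h1, -⟩
    · exact (h _ h1).trans (hab'.le.trans hjr)
    · have := hξ'.2 _ h1
      rw [LinearMap.neg_apply] at this
      linarith
    · rw [h1 heq, LinearMap.zero_apply]
      exact hir
  have hk : (wt a + wt b) ξ' = ((k₁ + k₂ : ℤ) : ℝ) := by
    rw [LinearMap.add_apply, hk₁, hk₂]
    push_cast
    rfl
  have hki : k₁ + k₂ ≤ i := by
    rw [hk] at hle
    exact_mod_cast hle
  refine Submodule.mem_iSup_of_mem (k₁ + k₂) (Submodule.mem_iSup_of_mem hki ?_)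
  rw [mem_adEigenspace, torusLie_lie_wedge, hk]
  push_cast
  rfl

/-- A root vector with a larger `ξ'`-eigenvalue would lie in a sum of other eigenspaces of `ad ξ'`,
contradicting their independence. -/
theorem Precedes.le {ξ ξ' : Torus n} (hξ : ξ ∈ integerLattice n) (h : Precedes ξ ξ') {a b : Idx n}
    (hab : a ≠ b) (h0 : 0 ≤ (wt a + wt b) ξ) : (wt a + wt b) ξ' ≤ (wt a + wt b) ξ := by
  obtain ⟨k₁, hk₁⟩ := wt_int hξ a
  obtain ⟨k₂, hk₂⟩ := wt_int hξ b
  have hk : (wt a + wt b) ξ = ((k₁ + k₂ : ℤ) : ℝ) := by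
    rw [LinearMap.add_apply, hk₁, hk₂]
    push_cast
    rfl
  rw [hk] at h0 ⊢
  have hm : wedge (isoVec a) (isoVec b) ∈ parabolic ξ' (k₁ + k₂) := by
    refine h (k₁ + k₂) (by exact_mod_cast h0)
      (Submodule.mem_iSup_of_mem (k₁ + k₂) (Submodule.mem_iSup_of_mem le_rfl ?_))
    rw [mem_adEigenspace, torusLie_lie_wedge, hk]
    push_cast
    rfl
  by_contra! hlt
  set f := LieAlgebra.ad ℂ (so n) (torusLie ξ')
  set c : ℂ := Complex.I * (((wt a + wt b) ξ' : ℝ) : ℂ)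
  have h1 : wedge (isoVec a) (isoVec b) ∈ f.eigenspace c :=
    Module.End.mem_eigenspace_iff.2 (torusLie_lie_wedge ξ' a b)
  have h2 : parabolic ξ' (k₁ + k₂) ≤ ⨆ (d : ℂ) (_ : d ≠ c), f.eigenspace d := by
    refine iSup_le fun j => iSup_le fun hj => ?_
    refine le_iSup₂_of_le (Complex.I * (j : ℂ)) ?_ le_rfl
    intro he
    have he' : (j : ℝ) = (wt a + wt b) ξ' := by
      exact_mod_cast mul_left_cancel₀ Complex.I_ne_zero he
    have : (j : ℝ) ≤ ((k₁ + k₂ : ℤ) : ℝ) := by exact_mod_cast hj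
    linarith
  exact wedge_isoVec_ne_zero hab
    (Submodule.disjoint_def.1 ((Module.End.eigenspaces_iSupIndep f) c) _ h1 (h2 hm))

/-- The coordinates of an element of the torus, extended by zero. -/
def coord (ξ : Torus n) (j : ℕ) : ℝ := if h : j < n then ξ ⟨j, h⟩ else 0

theorem coord_val (ξ : Torus n) (i : Fin n) : coord ξ i.val = ξ i := dif_pos i.2

theorem coord_of_le (ξ : Torus n) {j : ℕ} (h : n ≤ j) : coord ξ j = 0 := dif_neg (not_lt.2 h)

theorem dominant_iff {ξ : Torus n} :
    (∀ α ∈ posRoots n, 0 ≤ α ξ) ↔ Antitone ξ ∧ ∀ i, 0 ≤ ξ i := by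
  constructor
  · intro h
    refine ⟨antitone_iff_forall_lt.2 fun i j hij => ?_, fun i => h _ (Or.inr ⟨i, rfl⟩)⟩
    have := h (L i - L j) (Or.inl ⟨i, j, hij, Or.inl rfl⟩)
    simpa [L] using this
  · rintro ⟨h1, h2⟩ α hα
    exact nonneg_of_dominant h1 h2 hα

theorem coord_antitone {ξ : Torus n} (h : ∀ α ∈ posRoots n, 0 ≤ α ξ) : Antitone (coord ξ) := by
  obtain ⟨h1, h2⟩ := dominant_iff.1 h
  intro i j hij
  by_cases hj : j < n
  · rw [coord, coord, dif_pos hj, dif_pos (hij.trans_lt hj)]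
    exact h1 hij
  · rw [coord_of_le ξ (not_lt.1 hj), coord]
    split_ifs
    · exact h2 _
    · exact le_rfl

theorem coord_int {ξ : Torus n} (h : ξ ∈ integerLattice n) (j : ℕ) : ∃ k : ℤ, coord ξ j = k := by
  by_cases hj : j < n
  · rw [coord, dif_pos hj]
    exact mem_integerLattice_iff.1 h _
  · exact ⟨0, by rw [coord_of_le ξ (not_lt.1 hj)]; simp⟩

theorem coord_even {ξ : Torus n} (h : ξ ∈ evenLattice n) (j : ℕ) :
    ∃ k : ℤ, coord ξ j = 2 * k := by
  by_cases hj : j < n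
  · rw [coord, dif_pos hj]
    exact mem_evenLattice_iff.1 h _
  · exact ⟨0, by rw [coord_of_le ξ (not_lt.1 hj)]; simp⟩

theorem coord_sub (ξ ξ' : Torus n) (j : ℕ) : coord (ξ - ξ') j = coord ξ j - coord ξ' j := by
  by_cases hj : j < n
  · simp [coord, dif_pos hj]
  · simp [coord_of_le _ (not_lt.1 hj)]

theorem H_dominant (i : Fin n) : ∀ α ∈ posRoots n, 0 ≤ α (H i) := by
  refine dominant_iff.2 ⟨fun j k hjk => ?_, fun j => ?_⟩
  · simp only [H]
    split_ifs with h1 h2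
    · exact le_rfl
    · exact absurd (hjk.trans h1) h2
    · norm_num
    · exact le_rfl
  · simp only [H]
    split_ifs <;> norm_num

/-- If the jump after `j` were at least `2`, then `ξ - 2 H` (with `H` having ones up to `j`) would
still be dominant, would differ from `ξ` by an even element and would have smaller positive root
values, contradicting maximality. -/
theorem IsSymmetricCanonical.coord_le {ξ : Torus n} (h : IsSymmetricCanonical ξ) {j : ℕ}
    (hj : j < n) : coord ξ j ≤ coord ξ (j + 1) + 1 := by
  obtain ⟨⟨hint, hdom⟩, hmax⟩ := h
  by_contra! hlt
  set i : Fin n := ⟨j, hj⟩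
  have hanti := coord_antitone hdom
  have h2 : coord ξ (j + 1) + 2 ≤ ξ i := by
    obtain ⟨k, hk⟩ := coord_int hint j
    obtain ⟨l, hl⟩ := coord_int hint (j + 1)
    have : ξ i = k := (coord_val ξ i).symm.trans hk
    rw [hk, hl] at hlt
    rw [hl, this]
    have : l + 1 < k := by exact_mod_cast hlt
    have : l + 2 ≤ k := by omega
    exact_mod_cast this
  have hc0 : 0 ≤ coord ξ (j + 1) := by
    have := hanti (le_max_left (j + 1) n)
    rwa [coord_of_le ξ (le_max_right (j + 1) n)] at this
  have hbelow : ∀ l : Fin n, l ≤ i → coord ξ (j + 1) + 2 ≤ ξ l := fun l hl =>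
    h2.trans ((dominant_iff.1 hdom).1 hl)
  have habove : ∀ l : Fin n, ¬ l ≤ i → ξ l ≤ coord ξ (j + 1) := fun l hl => by
    rw [← coord_val ξ l]
    exact hanti (not_le.1 hl)
  have hdom' : ∀ α ∈ posRoots n, 0 ≤ α (ξ - (2 : ℝ) • H i) := by
    refine dominant_iff.2 ⟨fun k l hkl => ?_, fun k => ?_⟩
    · have hξ := (dominant_iff.1 hdom).1 hkl
      simp only [Pi.sub_apply, Pi.smul_apply, H, smul_eq_mul]
      split_ifs with h3 h4 h4
      · linarith
      · exact absurd (hkl.trans h3) h4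
      · have := hbelow k h4
        have := habove l h3
        linarith
      · linarith
    · have := (dominant_iff.1 hdom).2 k
      simp only [Pi.sub_apply, Pi.smul_apply, H, smul_eq_mul]
      split_ifs with h3
      · have := hbelow k h3
        linarith
      · linarith
  have hint' : ξ - (2 : ℝ) • H i ∈ integerLattice n := by
    rw [mem_integerLattice_iff] at hint ⊢
    intro k
    obtain ⟨a, ha⟩ := hint k
    simp only [Pi.sub_apply, Pi.smul_apply, H, smul_eq_mul, ha]
    split_ifs
    · exact ⟨a - 2, by push_cast; ring⟩
    · exact ⟨a, by ring⟩
  have heq := hmax _ ⟨hint', hdom'⟩ ⟨precedes_of_le ⟨hint', hdom'⟩ fun α hα => by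
    have := H_dominant i α hα
    rw [map_sub, map_smul, smul_eq_mul]
    linarith, by
    rw [sub_sub_cancel, mem_evenLattice_iff]
    intro k
    simp only [Pi.smul_apply, H, smul_eq_mul]
    split_ifs
    · exact ⟨1, by norm_num⟩
    · exact ⟨0, by norm_num⟩⟩
  have := congrFun heq i
  simp [H] at this
  linarith

/-- The order makes the simple root values of `ξ'` at most those of `ξ`, which are `0` or `1`, and
the lattice condition preserves parity. So they agree, by induction upwards from the zero coordinate
at index `n`. -/
theorem isSymmetricCanonical_of_coord_le {ξ : Torus n} (hξ : ξ ∈ dominantLattice n)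
    (h : ∀ j < n, coord ξ j ≤ coord ξ (j + 1) + 1) : IsSymmetricCanonical ξ := by
  refine ⟨hξ, fun ξ' hξ' ⟨hp, he⟩ => ?_⟩
  have hanti := coord_antitone hξ.2
  have hanti' := coord_antitone hξ'.2
  have hstep : ∀ j < n, coord ξ' j - coord ξ' (j + 1) ≤ coord ξ j - coord ξ (j + 1) := by
    intro j hj
    by_cases hj1 : j + 1 < n
    · have := hp.le hξ.1 (a := Sum.inl (Sum.inl ⟨j, hj⟩)) (b := Sum.inl (Sum.inr ⟨j + 1, hj1⟩))
        (by simp) (by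
          have := hanti (Nat.le_succ j)
          simp only [coord, dif_pos hj, dif_pos hj1, Nat.succ_eq_add_one] at this
          simpa [wt, L] using this)
      simp only [coord, dif_pos hj, dif_pos hj1]
      simp only [wt, L, LinearMap.add_apply, LinearMap.neg_apply, LinearMap.proj_apply] at this
      linarith
    · have := hp.le hξ.1 (a := Sum.inl (Sum.inl ⟨j, hj⟩)) (b := Sum.inr ())
        (by simp) (by simpa [wt, L] using (dominant_iff.1 hξ.2).2 ⟨j, hj⟩)
      simp only [coord, dif_pos hj, dif_neg hj1]
      simpa [wt, L] using this
  have heq : ∀ k ≤ n, coord ξ (n - k) = coord ξ' (n - k) := by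
    intro k
    induction k with
    | zero => intro _; rw [coord_of_le ξ (by omega), coord_of_le ξ' (by omega)]
    | succ k ih =>
      intro hk
      have ih' := ih (by omega)
      obtain ⟨j, hj⟩ : ∃ j, n - (k + 1) = j := ⟨_, rfl⟩
      have hj' : n - k = j + 1 := by omega
      rw [hj'] at ih'
      rw [hj]
      have h1 := hstep j (by omega)
      have h2 := h j (by omega)
      have h3 := hanti' (Nat.le_succ j)
      rw [Nat.succ_eq_add_one] at h3
      obtain ⟨t, ht⟩ := coord_even he j
      rw [coord_sub] at ht
      -- Since the coordinates at `j + 1` agree, `2 t` is the difference of two jumps: nonnegative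
      -- by `h1`, at most `1` by `h2` and `h3`.
      have h4 : (0 : ℝ) ≤ 2 * t := by linarith
      have h5 : (2 : ℝ) * t ≤ 1 := by linarith
      have h6 : (0 : ℤ) ≤ 2 * t := by exact_mod_cast h4
      have h7 : 2 * t ≤ 1 := by exact_mod_cast h5
      have h8 : t = 0 := by omega
      rw [h8] at ht
      simp only [Int.cast_zero, mul_zero] at ht
      linarith
  ext i
  have := heq (n - i.val) (Nat.sub_le _ _)
  rwa [Nat.sub_sub_self i.2.le, coord_val, coord_val] at this

/-! ### Real projection matrices -/

section RealProjections

variable {ι : Type*} [Fintype ι] [DecidableEq ι]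

/-- The real orthogonal projection matrices of rank `m`. -/
def projections (ι : Type*) [Fintype ι] [DecidableEq ι] (m : ℕ) : Set (Matrix ι ι ℝ) :=
  {Q | Qᵀ = Q ∧ Q * Q = Q ∧ Q.trace = m}

theorem exists_orthogonal_diagonalization {Q : Matrix ι ι ℝ} (hQ : Qᵀ = Q) (hQ' : Q * Q = Q) :
    ∃ (U : Matrix ι ι ℝ) (e : ι → ℝ), U * Uᵀ = 1 ∧ (∀ i, e i = 0 ∨ e i = 1) ∧
      Q = U * diagonal e * Uᵀ := by
  have hA : Q.IsHermitian := by
    rw [IsHermitian, conjTranspose_eq_transpose_of_trivial, hQ]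
  set U : Matrix ι ι ℝ := hA.eigenvectorUnitary.1 with hU
  have hs : star U = Uᵀ := by rw [star_eq_conjTranspose, conjTranspose_eq_transpose_of_trivial]
  have hUU : U * Uᵀ = 1 := by rw [← hs]; exact Unitary.coe_mul_star_self _
  have hUU' : Uᵀ * U = 1 := by rw [← hs]; exact Unitary.coe_star_mul_self _
  have hspec : Q = U * diagonal hA.eigenvalues * Uᵀ := by
    have := hA.spectral_theorem
    rw [Unitary.conjStarAlgAut_apply] at this
    rw [← hs]
    exact this
  refine ⟨U, hA.eigenvalues, hUU, fun i => ?_, hspec⟩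
  have hd : diagonal hA.eigenvalues = Uᵀ * Q * U := by
    conv_rhs => rw [hspec]
    calc _ = (Uᵀ * U) * diagonal hA.eigenvalues * (Uᵀ * U) := by rw [hUU']; simp
      _ = _ := by simp only [mul_assoc]
  have hdd : diagonal hA.eigenvalues * diagonal hA.eigenvalues = diagonal hA.eigenvalues := by
    rw [hd]
    calc _ = Uᵀ * Q * (U * Uᵀ) * Q * U := by simp only [mul_assoc]
      _ = Uᵀ * (Q * Q) * U := by rw [hUU, mul_one]; simp only [mul_assoc]
      _ = _ := by rw [hQ']
  rw [diagonal_mul_diagonal] at hdd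
  have := congrFun (diagonal_injective hdd) i
  have h2 : hA.eigenvalues i * (hA.eigenvalues i - 1) = 0 := by
    rw [mul_sub, mul_one, sub_eq_zero]
    exact this
  rcases mul_eq_zero.1 h2 with h | h
  · exact Or.inl h
  · exact Or.inr (sub_eq_zero.1 h)

theorem exists_perm_of_sum_eq {ι : Type*} [Fintype ι] {e e' : ι → ℝ} (he : ∀ i, e i = 0 ∨ e i = 1)
    (he' : ∀ i, e' i = 0 ∨ e' i = 1) (h : ∑ i, e i = ∑ i, e' i) :
    ∃ σ : Equiv.Perm ι, ∀ i, e (σ i) = e' i := by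
  classical
  have hsum : ∀ f : ι → ℝ, (∀ i, f i = 0 ∨ f i = 1) →
      ∑ i, f i = Fintype.card {i // f i = 1} := by
    intro f hf
    rw [Fintype.card_subtype, Finset.card_filter]
    push_cast
    refine Finset.sum_congr rfl fun i _ => ?_
    rcases hf i with h | h <;> simp [h]
  rw [hsum e he, hsum e' he'] at h
  have hc : Fintype.card {i // e' i = 1} = Fintype.card {i // e i = 1} := by exact_mod_cast h.symm
  set φ := Fintype.equivOfCardEq hc
  refine ⟨φ.extendSubtype, fun i => ?_⟩
  by_cases hi : e' i = 1
  · rw [hi]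
    exact φ.extendSubtype_mem i hi
  · have h1 : ¬ e (φ.extendSubtype i) = 1 := φ.extendSubtype_not_mem i hi
    rw [(he' i).resolve_right hi, (he _).resolve_right h1]

/-- Permuting the columns of a diagonalizing orthogonal matrix puts the eigenvalues in the
prescribed order. -/
theorem exists_specialOrthogonal_conj [Nonempty ι] {Q : Matrix ι ι ℝ} (hQ : Qᵀ = Q)
    (hQ' : Q * Q = Q) {e : ι → ℝ} (he : ∀ i, e i = 0 ∨ e i = 1) (htr : Q.trace = ∑ i, e i) :
    ∃ g ∈ specialOrthogonalGroup ι ℝ, Q = g * diagonal e * gᵀ := by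
  obtain ⟨U, f, hU, hf, hUf⟩ := exists_orthogonal_diagonalization hQ hQ'
  have hU' : Uᵀ * U = 1 := mul_eq_one_comm.1 hU
  have hsum : ∑ i, f i = ∑ i, e i := by
    rw [← htr, hUf, trace_mul_cycle, hU', one_mul, trace_diagonal]
  obtain ⟨σ, hσ⟩ := exists_perm_of_sum_eq hf he hsum
  set W : Matrix ι ι ℝ := U.submatrix id σ with hW
  have hWW : W * Wᵀ = 1 := by
    rw [hW, transpose_submatrix, submatrix_mul_equiv, hU, submatrix_id_id]
  have hWe : Q = W * diagonal e * Wᵀ := by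
    have hd : diagonal e = (diagonal f).submatrix σ σ := by
      rw [submatrix_diagonal_equiv]
      congr 1
      ext i
      exact (hσ i).symm
    rw [hd, hW, transpose_submatrix, submatrix_mul_equiv, submatrix_mul_equiv, ← hUf]
    rfl
  obtain ⟨j⟩ := ‹Nonempty ι›
  -- Rescaling one column by the determinant makes it `1`; being diagonal, `R` does not disturb
  -- `diagonal e`.
  set R : Matrix ι ι ℝ := diagonal (Function.update 1 j W.det) with hR
  have hdet : W.det * W.det = 1 := by
    have := congrArg det hWW
    rwa [det_mul, det_transpose, det_one] at this
  have hRdet : R.det = W.det := by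
    rw [hR, det_diagonal, Finset.prod_update_of_mem (Finset.mem_univ j)]
    simp
  have hRR : R * R = 1 := by
    rw [hR, diagonal_mul_diagonal, ← diagonal_one]
    congr 1
    ext i
    by_cases hi : i = j
    · subst hi; simpa using hdet
    · simp [Function.update_of_ne hi]
  have hRt : Rᵀ = R := diagonal_transpose _
  have hRe : R * diagonal e * R = diagonal e := by
    have : R * diagonal e = diagonal e * R := by
      rw [hR, diagonal_mul_diagonal, diagonal_mul_diagonal]
      congr 1
      ext i
      exact mul_comm _ _
    rw [this, mul_assoc, hRR, mul_one]
  refine ⟨W * R, ?_, ?_⟩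
  · rw [mem_specialOrthogonalGroup_iff, mem_orthogonalGroup_iff]
    refine ⟨?_, by rw [det_mul, hRdet, hdet]⟩
    rw [transpose_mul, hRt, mul_assoc, ← mul_assoc R, hRR, one_mul, hWW]
  · rw [transpose_mul, hRt, hWe]
    conv_lhs => rw [← hRe]
    simp only [mul_assoc]

end RealProjections

/-! ### The real Grassmannian -/

/-- The inclusion of the real matrices. -/
noncomputable abbrev complexify (A : Matrix (Idx n) (Idx n) ℝ) : Matrix (Idx n) (Idx n) ℂ :=
  A.map (algebraMap ℝ ℂ)

theorem complexify_mul (A B : Matrix (Idx n) (Idx n) ℝ) :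
    complexify (A * B) = complexify A * complexify B := Matrix.map_mul

theorem complexify_one : complexify (1 : Matrix (Idx n) (Idx n) ℝ) = 1 :=
  Matrix.map_one _ (map_zero _) (map_one _)

theorem complexify_sub (A B : Matrix (Idx n) (Idx n) ℝ) :
    complexify (A - B) = complexify A - complexify B := Matrix.map_sub _ (map_sub _) _ _

theorem complexify_smul (c : ℝ) (A : Matrix (Idx n) (Idx n) ℝ) :
    complexify (c • A) = (c : ℂ) • complexify A := by
  ext i j
  simp

theorem complexify_injective :
    Function.Injective (complexify : Matrix (Idx n) (Idx n) ℝ → _) :=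
  Matrix.map_injective (algebraMap ℝ ℂ).injective

theorem complexify_conjTranspose (A : Matrix (Idx n) (Idx n) ℝ) :
    (complexify A)ᴴ = complexify Aᵀ := by
  ext i j
  simp [conjTranspose_apply]

theorem trace_complexify (A : Matrix (Idx n) (Idx n) ℝ) :
    (complexify A).trace = (A.trace : ℂ) := by
  simp [trace]

theorem toEuclideanCLM_projMatrix (V : Submodule ℂ (EuclideanSpace ℂ (Idx n))) :
    toEuclideanCLM (n := Idx n) (𝕜 := ℂ) (projMatrix V) = V.starProjection :=
  StarAlgEquiv.apply_symm_apply _ _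

theorem toEuclideanCLM_injective :
    Function.Injective (toEuclideanCLM (n := Idx n) (𝕜 := ℂ)) := EquivLike.injective _

theorem finrank_eq_trace (V : Submodule ℂ (EuclideanSpace ℂ (Idx n))) :
    (projMatrix V).trace = (Module.finrank ℂ V : ℂ) := by
  have h : LinearMap.IsProj V (V.starProjection : EuclideanSpace ℂ (Idx n) →ₗ[ℂ] _) :=
    ⟨fun x => V.starProjection_apply_mem x, fun x hx => V.starProjection_eq_self_iff.2 hx⟩
  rw [← h.trace, ← toEuclideanCLM_projMatrix, coe_toEuclideanCLM_eq_toEuclideanLin,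
    toEuclideanLin_eq_toLin_orthonormal, trace_toLin_eq]

theorem projMatrix_orthogonal (V : Submodule ℂ (EuclideanSpace ℂ (Idx n))) :
    projMatrix Vᗮ = 1 - projMatrix V := by
  rw [projMatrix, projMatrix, Submodule.starProjection_orthogonal', map_sub, map_one]

/-- Stability of `V` under conjugation is equivalent to reality of its projection matrix; this is
the direction from `V` to the matrix. -/
theorem exists_projection_of_mem_realGrassmannian {m : ℕ}
    {V : Submodule ℂ (EuclideanSpace ℂ (Idx n))} (hV : V ∈ realGrassmannian n m) :
    ∃ Q ∈ projections (Idx n) m, projMatrix V = complexify Q := by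
  set A := projMatrix V with hA
  obtain ⟨hdim, hconj⟩ := hV
  have hAA : A * A = A := by
    apply toEuclideanCLM_injective
    rw [map_mul, toEuclideanCLM_projMatrix]
    exact isStarProjection_starProjection.1
  have hAs : Aᴴ = A := by
    apply toEuclideanCLM_injective
    rw [← star_eq_conjTranspose, map_star, toEuclideanCLM_projMatrix]
    exact isStarProjection_starProjection.2
  set B : Matrix (Idx n) (Idx n) ℂ := A.map (starRingEnd ℂ) with hB
  have hBs : Bᴴ = B := by
    rw [hB, ← conjTranspose_map (starRingEnd ℂ) fun _ => rfl, hAs]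
  have hAV : ∀ x : Idx n → ℂ, WithLp.toLp 2 (A *ᵥ x) ∈ V := by
    intro x
    have := V.starProjection_apply_mem (WithLp.toLp 2 x)
    rwa [← toEuclideanCLM_projMatrix, toEuclideanCLM_toLp] at this
  have hVA : ∀ x : Idx n → ℂ, WithLp.toLp 2 x ∈ V → A *ᵥ x = x := by
    intro x hx
    have := V.starProjection_eq_self_iff.2 hx
    rw [← toEuclideanCLM_projMatrix, toEuclideanCLM_toLp] at this
    exact (WithLp.toLp_injective 2) this
  have hcm : ∀ (M : Matrix (Idx n) (Idx n) ℂ) (x : Idx n → ℂ),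
      M.map (starRingEnd ℂ) *ᵥ x = fun i => starRingEnd ℂ ((M *ᵥ fun j => starRingEnd ℂ (x j)) i) := by
    intro M x
    ext i
    simp [mulVec, dotProduct]
  have hBA : B * A = A := by
    refine Matrix.ext_of_mulVec_single fun j => ?_
    rw [← mulVec_mulVec, hB, hcm, hVA _ (hconj _ (hAV _))]
    simp
    rfl
  -- The adjoint of `B A = A` reads `A B = A`, and its complex conjugate reads `A B = B`.
  have hAB : A = B := by
    calc A = (B * A)ᴴ := by rw [hBA, hAs]
      _ = A * B := by rw [conjTranspose_mul, hAs, hBs]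
      _ = (B * A).map (starRingEnd ℂ) := by
        rw [Matrix.map_mul, hB]
        congr 1
        ext i j
        simp
      _ = B := by rw [hBA]
  have hreal : A = complexify (A.map Complex.re) := by
    ext i j
    have h := congrFun (congrFun hAB i) j
    rw [hB, map_apply] at h
    exact (Complex.conj_eq_iff_re.1 h.symm).symm
  refine ⟨A.map Complex.re, ⟨?_, ?_, ?_⟩, hreal⟩
  · apply complexify_injective
    rw [← complexify_conjTranspose, ← hreal, hAs]
  · apply complexify_injective
    rw [complexify_mul, ← hreal, hAA]
  · have h := finrank_eq_trace V
    rw [← hA, hreal, trace_complexify, hdim] at h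
    exact_mod_cast h

theorem exists_mem_realGrassmannian_of_projection {m : ℕ} {Q : Matrix (Idx n) (Idx n) ℝ}
    (hQ : Q ∈ projections (Idx n) m) :
    ∃ V ∈ realGrassmannian n m, projMatrix V = complexify Q := by
  obtain ⟨hQ1, hQ2, hQ3⟩ := hQ
  set T := toEuclideanCLM (n := Idx n) (𝕜 := ℂ) (complexify Q) with hT
  have hstar : IsStarProjection (complexify Q) :=
    ⟨by rw [IsIdempotentElem, ← complexify_mul, hQ2],
      by rw [IsSelfAdjoint, star_eq_conjTranspose, complexify_conjTranspose, hQ1]⟩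
  obtain ⟨_, hTV⟩ := isStarProjection_iff_eq_starProjection_range.1
    (hstar.map (toEuclideanCLM (n := Idx n) (𝕜 := ℂ)))
  set V := LinearMap.range (T : EuclideanSpace ℂ (Idx n) →ₗ[ℂ] EuclideanSpace ℂ (Idx n)) with hVdef
  have hP : projMatrix V = complexify Q := by
    apply toEuclideanCLM_injective
    rw [toEuclideanCLM_projMatrix]
    exact hTV.symm
  refine ⟨V, ⟨?_, ?_⟩, hP⟩
  · have h := finrank_eq_trace V
    rw [hP, trace_complexify, hQ3] at h
    exact_mod_cast h.symm
  · rintro x ⟨y, rfl⟩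
    refine ⟨WithLp.toLp 2 fun i => (starRingEnd ℂ) (y i), ?_⟩
    change T _ = _
    rw [hT, toEuclideanCLM_toLp]
    congr 1
    ext i
    change _ = (starRingEnd ℂ) ((T y).ofLp i)
    rw [hT, ofLp_toEuclideanCLM]
    simp [mulVec, dotProduct]

/-- The sign in the embedding of the Grassmannian. -/
def grassmannianSign (m : ℕ) : ℝ := if Even m then 1 else -1

theorem grassmannianSign_mul_self (m : ℕ) : grassmannianSign m * grassmannianSign m = 1 := by
  rw [grassmannianSign]
  split_ifs <;> norm_num

theorem image_realGrassmannian (m : ℕ) :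
    grassmannianEmbedding n m '' realGrassmannian n m =
      {A | ∃ Q ∈ projections (Idx n) m,
        A = complexify (grassmannianSign m • (1 - (2 : ℝ) • Q))} := by
  have key : ∀ (V : Submodule ℂ (EuclideanSpace ℂ (Idx n))) (Q : Matrix (Idx n) (Idx n) ℝ),
      projMatrix V = complexify Q → grassmannianEmbedding n m V
        = complexify (grassmannianSign m • (1 - (2 : ℝ) • Q)) := by
    intro V Q h
    rw [grassmannianEmbedding, projMatrix_orthogonal, h, complexify_smul, complexify_sub,
      complexify_one, complexify_smul, grassmannianSign]
    split_ifs
    · push_cast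
      module
    · push_cast
      module
  ext A
  constructor
  · rintro ⟨V, hV, rfl⟩
    obtain ⟨Q, hQ, h⟩ := exists_projection_of_mem_realGrassmannian hV
    exact ⟨Q, hQ, key V Q h⟩
  · rintro ⟨Q, hQ, rfl⟩
    obtain ⟨V, hV, h⟩ := exists_mem_realGrassmannian_of_projection hQ
    exact ⟨V, hV, key V Q h⟩

theorem specialOrthogonal_mul_transpose {g : Matrix (Idx n) (Idx n) ℝ}
    (hg : g ∈ specialOrthogonalGroup (Idx n) ℝ) : g * gᵀ = 1 :=
  (mem_orthogonalGroup_iff _ _).1 (mem_specialOrthogonalGroup_iff.1 hg).1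

theorem complexify_inv {g : Matrix (Idx n) (Idx n) ℝ}
    (hg : g ∈ specialOrthogonalGroup (Idx n) ℝ) : (complexify g)⁻¹ = complexify gᵀ := by
  apply inv_eq_right_inv
  rw [← complexify_mul, specialOrthogonal_mul_transpose hg, complexify_one]

theorem symmetricSpace_eq {ξ : Torus n} {D : Matrix (Idx n) (Idx n) ℝ}
    (h : loop ξ (-1) = complexify D) :
    symmetricSpace ξ = {A | ∃ g ∈ specialOrthogonalGroup (Idx n) ℝ,
      A = complexify (g * D * gᵀ)} := by
  ext A
  constructor
  · rintro ⟨_, ⟨g, hg, rfl⟩, rfl⟩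
    refine ⟨g, hg, ?_⟩
    rw [h, complexify_mul, complexify_mul, ← complexify_inv hg]
    rfl
  · rintro ⟨g, hg, rfl⟩
    refine ⟨complexify g, ⟨g, hg, rfl⟩, ?_⟩
    rw [h, complexify_mul, complexify_mul, ← complexify_inv hg]

theorem sum_paritySign (a : Fin n → ℤ) :
    ∑ b, paritySign a b = 1 + 2 * ∑ i, (if Even (a i) then (1 : ℝ) else -1) := by
  rw [Fintype.sum_sum_type, Fintype.sum_sum_type]
  simp only [paritySign, Finset.univ_unique, Finset.sum_singleton]
  ring

theorem card_idx : (Fintype.card (Idx n) : ℝ) = 2 * n + 1 := by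
  simp [Idx]
  ring

/-- Both sets are full conjugacy classes of matrices `± (1 - 2 Q)`, with `Q` a real projection and
the sign fixed by `m`. The trace determines the rank of `Q`, and the rank determines the class. -/
theorem isAssociated_iff {ξ : Torus n} {a : Fin n → ℤ} (h : ∀ i, ξ i = a i) (m : ℕ) :
    IsAssociated m ξ ↔ 1 + 2 * ∑ i, (if Even (a i) then (1 : ℝ) else -1)
      = grassmannianSign m * (2 * n + 1 - 2 * m) := by
  set s := grassmannianSign m with hs
  have hss : s * s = 1 := grassmannianSign_mul_self m
  have hl : loop ξ (-1) = complexify (diagonal (paritySign a)) := loop_neg_one h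
  rw [IsAssociated, image_realGrassmannian, symmetricSpace_eq hl, ← sum_paritySign]
  constructor
  · intro heq
    have h1 : complexify (diagonal (paritySign a)) ∈ {A | ∃ g ∈ specialOrthogonalGroup (Idx n) ℝ,
        A = complexify (g * diagonal (paritySign a) * gᵀ)} :=
      ⟨1, one_mem _, by rw [transpose_one, one_mul, mul_one]⟩
    rw [heq] at h1
    obtain ⟨Q, hQ, hD⟩ := h1
    have h2 := congrArg trace (complexify_injective hD)
    rw [trace_diagonal, trace_smul, trace_sub, trace_smul, trace_one, card_idx, hQ.2.2,
      smul_eq_mul, smul_eq_mul] at h2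
    exact h2
  · intro hsum
    -- Solution of `paritySign a b = s (1 - 2 e b)`, using `s² = 1`.
    set e : Idx n → ℝ := fun b => (1 - s * paritySign a b) / 2 with he
    have hD : diagonal (paritySign a) = s • (1 - (2 : ℝ) • diagonal e) := by
      ext b c
      by_cases hbc : b = c
      · subst hbc
        simp only [diagonal_apply_eq, Matrix.smul_apply, Matrix.sub_apply, one_apply_eq,
          smul_eq_mul, he]
        linear_combination (-paritySign a b) * hss
      · simp [hbc]
    have he01 : ∀ b, e b = 0 ∨ e b = 1 := by
      intro b
      have h1 : s = 1 ∨ s = -1 := by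
        rw [hs, grassmannianSign]
        split_ifs <;> simp
      have h2 : paritySign a b = 1 ∨ paritySign a b = -1 := by
        rcases b with (i | i) | i <;> simp only [paritySign]
        · split_ifs <;> simp
        · split_ifs <;> simp
        · simp
      simp only [he]
      rcases h1 with h1 | h1 <;> rcases h2 with h2 | h2 <;> rw [h1, h2] <;> norm_num
    have hesum : ∑ b, e b = m := by
      simp only [he]
      rw [← Finset.sum_div, Finset.sum_sub_distrib, ← Finset.mul_sum, hsum, Finset.sum_const,
        Finset.card_univ, nsmul_eq_mul, card_idx]
      linear_combination (-(2 * n + 1 - 2 * m) / 2 : ℝ) * hss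
    have hconj : ∀ g ∈ specialOrthogonalGroup (Idx n) ℝ, g * diagonal (paritySign a) * gᵀ
        = s • (1 - (2 : ℝ) • (g * diagonal e * gᵀ)) := by
      intro g hg
      rw [hD]
      simp only [mul_smul_comm, smul_mul_assoc, mul_sub, sub_mul, mul_one,
        specialOrthogonal_mul_transpose hg]
    ext A
    constructor
    · rintro ⟨g, hg, rfl⟩
      have hg' : gᵀ * g = 1 := mul_eq_one_comm.1 (specialOrthogonal_mul_transpose hg)
      refine ⟨g * diagonal e * gᵀ, ⟨?_, ?_, ?_⟩, by rw [hconj g hg]⟩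
      · simp [transpose_mul, mul_assoc]
      · calc _ = g * diagonal e * (gᵀ * g) * diagonal e * gᵀ := by simp only [mul_assoc]
          _ = g * (diagonal e * diagonal e) * gᵀ := by rw [hg', mul_one]; simp only [mul_assoc]
          _ = _ := by
            rw [diagonal_mul_diagonal]
            congr 3
            ext b
            rcases he01 b with h1 | h1 <;> rw [h1] <;> norm_num
      · rw [trace_mul_cycle, hg', one_mul, trace_diagonal, hesum]
    · rintro ⟨Q, hQ, rfl⟩
      obtain ⟨g, hg, hQg⟩ := exists_specialOrthogonal_conj hQ.1 hQ.2.1 he01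
        (hQ.2.2.trans hesum.symm)
      exact ⟨g, hg, by rw [hconj g hg, ← hQg]⟩

/-! ### Parity counts -/

/-- The right sides are twice the numbers of odd and of even values among `b 1, …, b N`. Climbing
from `0` by steps of at most `1`, the sequence takes every value `1, …, b N`; the left sides are `2
⌈b N / 2⌉` and `2 ⌊b N / 2⌋`. -/
theorem parity_count_bounds {b : ℕ → ℕ} (h0 : b 0 = 0) (N : ℕ)
    (h1 : ∀ t < N, b t ≤ b (t + 1)) (h2 : ∀ t < N, b (t + 1) ≤ b t + 1) :
    (b N : ℤ) + (b N % 2 : ℕ)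
        ≤ N - ∑ t ∈ Finset.range N, (if Even (b (t + 1)) then (1 : ℤ) else -1) ∧
      (b N : ℤ) - (b N % 2 : ℕ)
        ≤ N + ∑ t ∈ Finset.range N, (if Even (b (t + 1)) then (1 : ℤ) else -1) := by
  induction N with
  | zero => simp [h0]
  | succ N ih =>
    obtain ⟨ih1, ih2⟩ := ih (fun t ht => h1 t (ht.trans (Nat.lt_succ_self N)))
      (fun t ht => h2 t (ht.trans (Nat.lt_succ_self N)))
    have h3 := h1 N (Nat.lt_succ_self N)
    have h4 := h2 N (Nat.lt_succ_self N)
    rw [Finset.sum_range_succ]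
    split_ifs with he
    · rw [Nat.even_iff] at he
      push_cast
      omega
    · rw [Nat.even_iff] at he
      push_cast
      omega

/-- The signs alternate, starting with `-1`, for the first `m` terms and are constant afterwards. -/
theorem parity_sum_min (m N : ℕ) (h : m ≤ N) :
    ∑ t ∈ Finset.range N, (if Even (min m (t + 1)) then (1 : ℤ) else -1)
      = if Even m then (N : ℤ) - m else m - N - 1 := by
  have h1 : ∀ k ≤ m, ∑ t ∈ Finset.range k, (if Even (min m (t + 1)) then (1 : ℤ) else -1)
      = if Even k then 0 else -1 := by
    intro k
    induction k with
    | zero => simp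
    | succ k ih =>
      intro hk
      rw [Finset.sum_range_succ, ih (by omega), min_eq_right hk]
      simp only [Nat.even_add_one]
      split_ifs <;> simp_all
  obtain ⟨d, rfl⟩ := Nat.exists_eq_add_of_le h
  rw [Finset.sum_range_add, h1 m le_rfl]
  have h2 : ∀ t ∈ Finset.range d, (if Even (min m (m + t + 1)) then (1 : ℤ) else -1)
      = if Even m then 1 else -1 := by
    intro t _
    rw [min_eq_left (by omega)]
  rw [Finset.sum_congr rfl h2, Finset.sum_const, Finset.card_range]
  split_ifs <;> simp; ring

theorem isAssociated_iff_coord {ξ : Torus n} {c : ℕ → ℕ} (hc : ∀ j, coord ξ j = c j) (m : ℕ) :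
    IsAssociated m ξ ↔ 1 + 2 * ∑ t ∈ Finset.range n, (if Even (c (n - (t + 1))) then (1 : ℤ) else -1)
      = (if Even m then 1 else -1) * (2 * n + 1 - 2 * m) := by
  have hξ : ∀ i : Fin n, ξ i = ((c i.val : ℤ) : ℝ) := fun i => by
    rw [← coord_val ξ i, hc]
    simp
  have hsum : ∑ i : Fin n, (if Even (c i.val : ℤ) then (1 : ℝ) else -1)
      = ((∑ t ∈ Finset.range n, (if Even (c (n - (t + 1))) then (1 : ℤ) else -1) : ℤ) : ℝ) := by
    simp only [Int.even_coe_nat]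
    rw [Fin.sum_univ_eq_sum_range (fun j => if Even (c j) then (1 : ℝ) else -1),
      ← Finset.sum_range_reflect]
    push_cast
    refine Finset.sum_congr rfl fun t _ => ?_
    rw [show n - 1 - t = n - (t + 1) by omega]
  rw [isAssociated_iff hξ, hsum, grassmannianSign]
  rw [← Int.cast_inj (α := ℝ)]
  push_cast
  rfl

theorem exists_nat_coord {ξ : Torus n} (hξ : ξ ∈ dominantLattice n) :
    ∃ c : ℕ → ℕ, ∀ j, coord ξ j = c j := by
  have h : ∀ j, ∃ k : ℕ, coord ξ j = k := by
    intro j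
    obtain ⟨k, hk⟩ := coord_int hξ.1 j
    have h0 := coord_antitone hξ.2 (le_max_left j n)
    rw [coord_of_le ξ (le_max_right j n), hk] at h0
    have h1 : 0 ≤ k := by exact_mod_cast h0
    lift k to ℕ using h1
    exact ⟨k, by simpa using hk⟩
  choose c hc using h
  exact ⟨c, hc⟩

theorem IsSymmetricCanonical.coord_le_min {ξ : Torus n} (h : IsSymmetricCanonical ξ) {m : ℕ}
    (ha : IsAssociated m ξ) (j : ℕ) : coord ξ j ≤ ((min m (n - j) : ℕ) : ℝ) := by
  obtain ⟨c, hc⟩ := exists_nat_coord h.1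
  have hanti : Antitone c := fun i j hij => by
    have := coord_antitone h.1.2 hij
    rw [hc, hc] at this
    exact_mod_cast this
  have hstep : ∀ j < n, c j ≤ c (j + 1) + 1 := fun j hj => by
    have := h.coord_le hj
    rw [hc, hc] at this
    exact_mod_cast this
  have hn : c n = 0 := by
    have := coord_of_le ξ (le_refl n)
    rw [hc] at this
    exact_mod_cast this
  rw [isAssociated_iff_coord hc] at ha
  obtain ⟨h1, h2⟩ := parity_count_bounds (b := fun t => c (n - t)) (by simpa using hn) n
    (fun t ht => hanti (by omega))
    (fun t ht => by
      have := hstep (n - (t + 1)) (by omega)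
      rwa [show n - (t + 1) + 1 = n - t by omega] at this)
  simp only [Nat.sub_self] at h1 h2
  -- For even `m` the sign sum is `n - m` and `h1` applies. For odd `m` it is `m - n - 1`, and `h2`
  -- bounds `c 0` minus its parity by `m - 1`.
  have hm : c 0 ≤ m := by
    split_ifs at ha with hm
    · omega
    · rw [Nat.even_iff] at hm
      omega
  have hle : ∀ k ≤ n, c (n - k) ≤ k := by
    intro k
    induction k with
    | zero => intro _; simpa using hn.le
    | succ k ih =>
      intro hk
      have h3 := ih (by omega)
      have := hstep (n - (k + 1)) (by omega)
      rw [show n - (k + 1) + 1 = n - k by omega] at this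
      omega
  rw [hc]
  have h3 : c j ≤ m := (hanti (Nat.zero_le j)).trans hm
  have h4 : c j ≤ n - j := by
    by_cases hj : j ≤ n
    · have := hle (n - j) (Nat.sub_le _ _)
      rwa [Nat.sub_sub_self hj] at this
    · have := hanti (le_of_not_ge hj)
      omega
  exact_mod_cast le_min h3 h4

/-! ### The extremal element -/

theorem coord_extremal {m : ℕ} (hm : m ≤ n) (j : ℕ) :
    coord (extremal n m) j = ((min m (n - j) : ℕ) : ℝ) := by
  by_cases hj : j < n
  · rw [coord, dif_pos hj, extremal, Finset.sum_apply, Finset.sum_filter]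
    -- The coordinate at `j` counts the indices `l < n` with `l ≥ n - m` (from `I`) and `l ≥ j`
    -- (from the support of `H`).
    have h1 : ∀ i : Fin n, (if n - m + 1 ≤ i.val + 1 then (H i : Torus n) ⟨j, hj⟩ else 0)
        = (fun l : ℕ => if max (n - m) j ≤ l then (1 : ℝ) else 0) i.val := by
      intro i
      have h2 : ((⟨j, hj⟩ : Fin n) ≤ i) = (j ≤ i.val) := rfl
      simp only [H, h2]
      by_cases h3 : n - m ≤ i.val <;> by_cases h4 : j ≤ i.val <;> simp [h3, h4]
    rw [Finset.sum_congr rfl fun i _ => h1 i,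
      Fin.sum_univ_eq_sum_range (fun l : ℕ => if max (n - m) j ≤ l then (1 : ℝ) else 0),
      ← Finset.sum_filter, Finset.sum_const, nsmul_eq_mul, mul_one]
    congr 1
    have : (Finset.range n).filter (fun l => max (n - m) j ≤ l) = Finset.Ico (max (n - m) j) n := by
      ext l
      simp only [Finset.mem_filter, Finset.mem_range, Finset.mem_Ico]
      tauto
    rw [this, Nat.card_Ico]
    omega
  · rw [coord_of_le _ (not_lt.1 hj), Nat.sub_eq_zero_of_le (not_lt.1 hj)]
    simp

theorem extremal_mem_dominantLattice {m : ℕ} (hm : m ≤ n) : extremal n m ∈ dominantLattice n := by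
  have h : ∀ i : Fin n, extremal n m i = ((min m (n - i.val) : ℕ) : ℝ) := fun i => by
    rw [← coord_val (extremal n m) i, coord_extremal hm]
  refine ⟨mem_integerLattice_iff.2 fun i => ⟨(min m (n - i.val) : ℕ), by rw [h]; simp⟩,
    dominant_iff.2 ⟨fun i j hij => ?_, fun i => ?_⟩⟩
  · rw [h, h]
    have : i.val ≤ j.val := hij
    exact_mod_cast (by omega : min m (n - j.val) ≤ min m (n - i.val))
  · rw [h]
    positivity

theorem isSymmetricCanonical_extremal {m : ℕ} (hm : m ≤ n) :
    IsSymmetricCanonical (extremal n m) := by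
  refine isSymmetricCanonical_of_coord_le (extremal_mem_dominantLattice hm) fun j hj => ?_
  rw [coord_extremal hm, coord_extremal hm]
  exact_mod_cast (by omega : min m (n - j) ≤ min m (n - (j + 1)) + 1)

theorem isAssociated_extremal {m : ℕ} (hm : m ≤ n) : IsAssociated m (extremal n m) := by
  rw [isAssociated_iff_coord (coord_extremal hm)]
  have h : ∀ t ∈ Finset.range n, (if Even (min m (n - (n - (t + 1)))) then (1 : ℤ) else -1)
      = if Even (min m (t + 1)) then (1 : ℤ) else -1 := by
    intro t ht
    rw [Finset.mem_range] at ht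
    rw [Nat.sub_sub_self ht]
  rw [Finset.sum_congr rfl h, parity_sum_min m n hm]
  split_ifs <;> ring

theorem IsSymmetricCanonical.coord_le_extremal {ξ : Torus n} (h : IsSymmetricCanonical ξ) {m : ℕ}
    (hm : m ≤ n) (ha : IsAssociated m ξ) (j : ℕ) : coord ξ j ≤ coord (extremal n m) j := by
  rw [coord_extremal hm]
  exact h.coord_le_min ha j

/-! ### Values of the fundamental weights -/

theorem sum_filter_coord (ξ : Torus n) {k : ℕ} (hk : k ≤ n) :
    ∑ i : Fin n with i.val < k, ξ i = ∑ j ∈ Finset.range k, coord ξ j := by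
  rw [Finset.sum_filter]
  have : ∀ i : Fin n, (if i.val < k then ξ i else 0)
      = (fun j : ℕ => if j < k then coord ξ j else 0) i.val := fun i => by
    simp only [coord_val]
  rw [Finset.sum_congr rfl fun i _ => this i,
    Fin.sum_univ_eq_sum_range (fun j : ℕ => if j < k then coord ξ j else 0), ← Finset.sum_filter]
  congr 1
  ext j
  simp only [Finset.mem_filter, Finset.mem_range]
  omega

theorem two_mul_fundamentalWeight_of_lt (ξ : Torus n) {k : ℕ} (hk : k < n) :
    2 * fundamentalWeight n k ξ = 2 * ∑ j ∈ Finset.range k, coord ξ j := by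
  rw [fundamentalWeight, if_pos hk, ← sum_filter_coord ξ hk.le, LinearMap.sum_apply]
  rfl

theorem two_mul_fundamentalWeight_self (ξ : Torus n) :
    2 * fundamentalWeight n n ξ = ∑ j ∈ Finset.range n, coord ξ j := by
  rw [fundamentalWeight, if_neg (lt_irrefl n), LinearMap.smul_apply, LinearMap.sum_apply,
    ← Fin.sum_univ_eq_sum_range]
  simp only [coord_val, smul_eq_mul, L, LinearMap.proj_apply]
  ring

theorem fundamentalWeight_mono {ξ ξ' : Torus n} (h : ∀ j, coord ξ j ≤ coord ξ' j) {k : ℕ}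
    (hk : k ≤ n) : 2 * fundamentalWeight n k ξ ≤ 2 * fundamentalWeight n k ξ' := by
  rcases hk.lt_or_eq with hk | rfl
  · rw [two_mul_fundamentalWeight_of_lt _ hk, two_mul_fundamentalWeight_of_lt _ hk]
    have := Finset.sum_le_sum (s := Finset.range k) fun j _ => h j
    linarith
  · rw [two_mul_fundamentalWeight_self, two_mul_fundamentalWeight_self]
    exact Finset.sum_le_sum fun j _ => h j

theorem sum_extremal_of_le {m k : ℕ} (hm : m ≤ n) (hk : k ≤ n - m + 1) :
    ∑ j ∈ Finset.range k, coord (extremal n m) j = m * k := by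
  have : ∀ j ∈ Finset.range k, coord (extremal n m) j = m := by
    intro j hj
    rw [Finset.mem_range] at hj
    rw [coord_extremal hm, min_eq_left (by omega)]
  rw [Finset.sum_congr rfl this, Finset.sum_const, Finset.card_range, nsmul_eq_mul, mul_comm]

/-- At index `n - m` both expressions in `min m (n - j)` equal `m`, so the linear regime extends to
`k = n - m + 1`, where the induction starts. -/
theorem sum_extremal_of_ge {m k : ℕ} (hm : m ≤ n) (hk : n - m + 1 ≤ k) (hkn : k ≤ n) :
    2 * ∑ j ∈ Finset.range k, coord (extremal n m) j
      = 2 * m * ((n : ℝ) - m + 1) + ((k : ℝ) - n + m - 1) * ((m : ℝ) + n - k) := by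
  induction k, hk using Nat.le_induction with
  | base =>
    rw [sum_extremal_of_le hm le_rfl]
    push_cast [Nat.cast_sub hm]
    ring
  | succ k hk ih =>
    rw [Finset.sum_range_succ, mul_add, ih (by omega), coord_extremal hm,
      min_eq_right (by omega), Nat.cast_sub (by omega)]
    push_cast
    ring

/-! ### Uniton numbers of the extremal element -/

section Bounds

variable {V : Type u} [AddCommGroup V] [Module ℂ V] [LieRingModule (so n) V]
  [LieModule ℂ (so n) V] {m k : ℕ}

theorem unitonNumber_le_extremal (hm : m ≤ n) (hk : k ≤ n) (hV : IsFundamentalRep n k V)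
    {ξ : Torus n} (h : IsSymmetricCanonical ξ) (ha : IsAssociated m ξ) :
    unitonNumber V ξ ≤ unitonNumber V (extremal n m) := by
  rw [unitonNumber_fundamental hV, unitonNumber_fundamental hV]
  exact fundamentalWeight_mono (h.coord_le_extremal hm ha) hk

theorem unitonNumber_extremal_of_le (hm : m ≤ n) (hV : IsFundamentalRep n k V)
    (hk : k ≤ n - m + 1) (hkn : k < n) : unitonNumber V (extremal n m) = 2 * m * k := by
  rw [unitonNumber_fundamental hV, two_mul_fundamentalWeight_of_lt _ hkn, sum_extremal_of_le hm hk]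
  ring

theorem unitonNumber_extremal_of_lt (hm : m ≤ n) (hV : IsFundamentalRep n k V)
    (hk : n - m + 1 < k) (hkn : k < n) : unitonNumber V (extremal n m)
      = 2 * m * ((n : ℝ) - m + 1) + ((k : ℝ) - n + m - 1) * ((m : ℝ) + n - k) := by
  rw [unitonNumber_fundamental hV, two_mul_fundamentalWeight_of_lt _ hkn,
    sum_extremal_of_ge hm hk.le hkn.le]

/-- For `k = n` the weight is half the sum of the `Lᵢ`, so the value is only `m k` and equality is
not claimed there. -/
theorem unitonNumber_extremal_le (hm : m ≤ n) (hV : IsFundamentalRep n k V)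
    (hk : k ≤ n - m + 1) (hkn : k ≤ n) : unitonNumber V (extremal n m) ≤ 2 * m * k := by
  rcases hkn.lt_or_eq with hkn | rfl
  · exact (unitonNumber_extremal_of_le hm hV hk hkn).le
  · rw [unitonNumber_fundamental hV, two_mul_fundamentalWeight_self, sum_extremal_of_le hm hk]
    have : (0 : ℝ) ≤ m * k := by positivity
    linarith

theorem unitonNumber_two_extremal_le (hV : IsFundamentalRep n 2 V) (hn : 2 ≤ n) :
    unitonNumber V (extremal n n) ≤ 4 * (n : ℝ) - 2 := by
  rcases hn.lt_or_eq with hn | rfl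
  · rw [unitonNumber_extremal_of_lt le_rfl hV (by omega) hn]
    push_cast
    linarith
  -- For `n = 2` the representation `ρ₂` is the spin representation: the value is `3`, below the
  -- bound `6`.
  · have h := sum_extremal_of_ge (le_refl 2) (by omega : 2 - 2 + 1 ≤ 2) le_rfl
    rw [unitonNumber_fundamental hV, two_mul_fundamentalWeight_self]
    norm_num at h ⊢
    linarith

end Bounds

theorem unitonNumber_standard_eq (hn : 1 ≤ n) (ξ : Torus n) :
    unitonNumber (Standard n) ξ = 2 * coord ξ 0 := by
  rw [unitonNumber_standard hn, ← coord_val ξ (fstIdx hn)]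

/-- The extension of the coordinates by zero makes the formula cover `n = 1`, where the highest root
is `L₁`. -/
theorem unitonNumber_adjoint_eq (hn : 1 ≤ n) (ξ : Torus n) :
    unitonNumber (Adjoint n) ξ = 2 * (coord ξ 0 + coord ξ 1) := by
  rcases hn.lt_or_eq with hn | rfl
  · rw [unitonNumber_adjoint hn, ← coord_val ξ, ← coord_val ξ]
  · rw [unitonNumber_adjoint_one, ← coord_val ξ, coord_of_le ξ le_rfl, add_zero]

theorem unitonNumber_standard_extremal {m : ℕ} (hn : 1 ≤ n) (hm : m ≤ n) :
    unitonNumber (Standard n) (extremal n m) = 2 * m := by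
  rw [unitonNumber_standard_eq hn, coord_extremal hm, min_eq_left (by omega)]

theorem unitonNumber_adjoint_extremal_of_lt {m : ℕ} (hn : 1 ≤ n) (hm : m < n) :
    unitonNumber (Adjoint n) (extremal n m) = 4 * m := by
  rw [unitonNumber_adjoint_eq hn, coord_extremal hm.le, coord_extremal hm.le,
    min_eq_left (by omega), min_eq_left (by omega)]
  ring

theorem unitonNumber_adjoint_extremal_self (hn : 1 ≤ n) :
    unitonNumber (Adjoint n) (extremal n n) = 4 * (n : ℝ) - 2 := by
  rw [unitonNumber_adjoint_eq hn, coord_extremal le_rfl, coord_extremal le_rfl,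
    min_eq_left (by omega), min_eq_right (by omega), Nat.cast_sub hn]
  push_cast
  ring

theorem unitonNumber_standard_le {m : ℕ} (hn : 1 ≤ n) (hm : m ≤ n) {ξ : Torus n}
    (h : IsSymmetricCanonical ξ) (ha : IsAssociated m ξ) :
    unitonNumber (Standard n) ξ ≤ unitonNumber (Standard n) (extremal n m) := by
  rw [unitonNumber_standard_eq hn, unitonNumber_standard_eq hn]
  have := h.coord_le_extremal hm ha 0
  linarith

theorem unitonNumber_adjoint_le {m : ℕ} (hn : 1 ≤ n) (hm : m ≤ n) {ξ : Torus n}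
    (h : IsSymmetricCanonical ξ) (ha : IsAssociated m ξ) :
    unitonNumber (Adjoint n) ξ ≤ unitonNumber (Adjoint n) (extremal n m) := by
  rw [unitonNumber_adjoint_eq hn, unitonNumber_adjoint_eq hn]
  have := h.coord_le_extremal hm ha 0
  have := h.coord_le_extremal hm ha 1
  linarith

end OddOrthogonal

open OddOrthogonal in
theorem mainTheorem11 (n m : ℕ) (hn : 1 ≤ n) (hm : m ≤ n) :
    (∀ ξ : Torus n, IsSymmetricCanonical ξ → IsAssociated m ξ →
      (∀ (k : ℕ) (V : Type u) [AddCommGroup V] [Module ℂ V] [LieRingModule (so n) V]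
          [LieModule ℂ (so n) V], 1 ≤ k → k ≤ n → IsFundamentalRep n k V →
        (k ≤ n - m + 1 → unitonNumber V ξ ≤ 2 * m * k) ∧
        (n - m + 1 < k → k < n → unitonNumber V ξ ≤
          2 * m * ((n : ℝ) - m + 1) + ((k : ℝ) - n + m - 1) * ((m : ℝ) + n - k)) ∧
        (k = 1 → unitonNumber V ξ ≤ 2 * m) ∧
        (k = 2 → m < n → unitonNumber V ξ ≤ 4 * m) ∧
        (k = 2 → m = n → unitonNumber V ξ ≤ 4 * (m : ℝ) - 2)) ∧
      unitonNumber (Standard n) ξ ≤ 2 * m ∧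
      (m < n → unitonNumber (Adjoint n) ξ ≤ 4 * m) ∧
      (m = n → unitonNumber (Adjoint n) ξ ≤ 4 * (m : ℝ) - 2)) ∧
    IsSymmetricCanonical (extremal n m) ∧ IsAssociated m (extremal n m) ∧
    (∀ (k : ℕ) (V : Type u) [AddCommGroup V] [Module ℂ V] [LieRingModule (so n) V]
        [LieModule ℂ (so n) V], 1 ≤ k → k ≤ n → IsFundamentalRep n k V →
      (∀ ξ : Torus n, IsSymmetricCanonical ξ → IsAssociated m ξ →
        unitonNumber V ξ ≤ unitonNumber V (extremal n m)) ∧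
      (k ≤ n - m + 1 → k < n → unitonNumber V (extremal n m) = 2 * m * k) ∧
      (n - m + 1 < k → k < n → unitonNumber V (extremal n m) =
        2 * m * ((n : ℝ) - m + 1) + ((k : ℝ) - n + m - 1) * ((m : ℝ) + n - k))) ∧
    unitonNumber (Standard n) (extremal n m) = 2 * m ∧
    (m < n → unitonNumber (Adjoint n) (extremal n m) = 4 * m) ∧
    (m = n → unitonNumber (Adjoint n) (extremal n m) = 4 * (m : ℝ) - 2) := by
  refine ⟨fun ξ h ha => ⟨?_, ?_, ?_, ?_⟩, isSymmetricCanonical_extremal hm,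
    isAssociated_extremal hm, ?_, unitonNumber_standard_extremal hn hm,
    unitonNumber_adjoint_extremal_of_lt hn, ?_⟩
  · intro k V _ _ _ _ hk hkn hV
    have hle := unitonNumber_le_extremal hm hkn hV h ha
    refine ⟨fun h1 => hle.trans (unitonNumber_extremal_le hm hV h1 hkn),
      fun h1 h2 => hle.trans (unitonNumber_extremal_of_lt hm hV h1 h2).le, ?_, ?_, ?_⟩
    · rintro rfl
      refine hle.trans ((unitonNumber_extremal_le hm hV (by omega) hkn).trans_eq ?_)
      push_cast
      ring
    · rintro rfl hmn
      refine hle.trans ((unitonNumber_extremal_le hm hV (by omega) hkn).trans_eq ?_)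
      push_cast
      ring
    · rintro rfl rfl
      exact hle.trans (unitonNumber_two_extremal_le hV hkn)
  · exact (unitonNumber_standard_le hn hm h ha).trans_eq (unitonNumber_standard_extremal hn hm)
  · intro hmn
    exact (unitonNumber_adjoint_le hn hm h ha).trans_eq
      (unitonNumber_adjoint_extremal_of_lt hn hmn)
  · rintro rfl
    exact (unitonNumber_adjoint_le hn hm h ha).trans_eq (unitonNumber_adjoint_extremal_self hn)
  · intro k V _ _ _ _ hk hkn hV
    exact ⟨fun ξ h ha => unitonNumber_le_extremal hm hkn hV h ha,
      unitonNumber_extremal_of_le hm hV, unitonNumber_extremal_of_lt hm hV⟩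
  · rintro rfl
    exact unitonNumber_adjoint_extremal_self hn
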